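/- Let $1 < p \le 2 \le q < \infty$ with $p$ and $q$ not both equal to $2$. There is a constant $C = C_{p,q} > 0$, depending only on $p$ and $q$, such that the following holds. Let $L$ be a lattice in $\mathbb{R}^d$ (the $\mathbb{Z}$-span of $d$ linearly independent vectors), let $L^\perp = \{\kappa \in \mathbb{R}^d : \kappa\cdot\lambda \in \mathbb{Z} \text{ for all } \lambda \in L\}$ be its dual lattice, and let $\Omega$ be a fundamental domain of $L$, i.e. a measurable set containing exactly one representative of every coset of $\mathbb{R}^d/L$. Let $L^p(\Omega)$ denote the Lebesgue space with respect to the normalized measure $|\Omega|^{-1}dx$ on $\Omega$, let $C^\infty(\Omega)$ be the space of smooth $L$-periodic functions $\mathbb{R}^d \to \mathbb{C}$, and put $\widehat{f}(\kappa) = \frac{1}{|\Omega|}\int_\Omega f(x) e^{-2\pi i \kappa\cdot x}\,dx$ for $\kappa \in L^\perp$. Let $A : C^\infty(\Omega) \to C^\infty(\Omega)$ be a Fourier multiplier with symbol $\sigma : L^\perp \to \mathbb{C}$, i.e. $\widehat{Af}(\kappa) = \sigma(\kappa)\widehat{f}(\kappa)$ for all $f \in C^\infty(\Omega)$ and $\kappa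 \in L^\perp$, and suppose that $$M := \sup_{s>0} s\,\bigl(\#\{\kappa \in L^\perp : |\sigma(\kappa)| \ge s\}\bigr)^{\frac1p-\frac1q} < \infty .$$ Then $$\sup_{0 \ne f \in C^\infty(\Omega)} \frac{\|Af\|_{L^q(\Omega)}}{\|f\|_{L^p(\Omega)}} \le C\,M ,$$ and $A$ extends to a bounded linear operator $L^p(\Omega) \to L^q(\Omega)$ of norm at most $C M$. -/

import Mathlib

open MeasureTheory
open scoped ENNReal NNReal

noncomputable section

namespace LatticeFourier

/-- The dual lattice `L^⊥ = {κ | ∀ l ∈ L, κ · l ∈ ℤ}` of a lattice `L` in `ℝ^d`. -/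
def dualLattice {d : ℕ} (L : Submodule ℤ (EuclideanSpace ℝ (Fin d))) :
    Submodule ℤ (EuclideanSpace ℝ (Fin d)) :=
  LinearMap.BilinForm.dualSubmodule (innerₗ (EuclideanSpace ℝ (Fin d))) L

theorem mem_dualLattice {d : ℕ} {L : Submodule ℤ (EuclideanSpace ℝ (Fin d))}
    {κ : EuclideanSpace ℝ (Fin d)} :
    κ ∈ dualLattice L ↔ ∀ l ∈ L, ∃ n : ℤ, inner ℝ κ l = (n : ℝ) := by
  simp only [dualLattice, LinearMap.BilinForm.mem_dualSubmodule, Submodule.mem_one,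
    innerₗ_apply_apply, eq_intCast, eq_comm]

/-- A fundamental domain of `L`: a (Lebesgue) measurable set which contains exactly one
representative of every coset of `ℝ^d / L`. -/
structure IsFundDomain {d : ℕ} (L : Submodule ℤ (EuclideanSpace ℝ (Fin d)))
    (Ω : Set (EuclideanSpace ℝ (Fin d))) : Prop where
  nullMeasurableSet : NullMeasurableSet Ω volume
  existsUnique : ∀ x : EuclideanSpace ℝ (Fin d),
    ∃! l : EuclideanSpace ℝ (Fin d), l ∈ L ∧ x + l ∈ Ω

/-- The normalized Lebesgue measure `|Ω|⁻¹ dx` on `Ω`. The spaces `L^p(Ω)` are taken with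
respect to this measure. -/
def normMeasure {d : ℕ} (Ω : Set (EuclideanSpace ℝ (Fin d))) :
    Measure (EuclideanSpace ℝ (Fin d)) :=
  (volume Ω)⁻¹ • volume.restrict Ω

/-- The space `C^∞(Ω)`: the smooth `L`-periodic functions `ℝ^d → ℂ`. -/
def smoothPeriodic {d : ℕ} (L : Submodule ℤ (EuclideanSpace ℝ (Fin d))) :
    Submodule ℂ (EuclideanSpace ℝ (Fin d) → ℂ) where
  carrier := {f | ContDiff ℝ ((⊤ : ℕ∞) : WithTop ℕ∞) f ∧ ∀ x, ∀ l ∈ L, f (x + l) = f x}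
  add_mem' := by
    rintro f g ⟨hf, hf'⟩ ⟨hg, hg'⟩
    exact ⟨hf.add hg, fun x l hl => by simp [hf' x l hl, hg' x l hl]⟩
  zero_mem' := ⟨contDiff_const, fun _ _ _ => rfl⟩
  smul_mem' := by
    rintro c f ⟨hf, hf'⟩
    exact ⟨contDiff_const.smul hf, fun x l hl => by simp [hf' x l hl]⟩

/-- The Fourier coefficient `|Ω|⁻¹ ∫_Ω f(x) e^{-2πi κ·x} dx`. -/
def fourierCoef {d : ℕ} (Ω : Set (EuclideanSpace ℝ (Fin d)))
    (f : EuclideanSpace ℝ (Fin d) → ℂ) (κ : EuclideanSpace ℝ (Fin d)) : ℂ :=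
  ∫ x, f x * Complex.exp (-(2 * Real.pi * Complex.I * (inner ℝ κ x : ℝ))) ∂(normMeasure Ω)

/-- `A : C^∞(Ω) → C^∞(Ω)` is a Fourier multiplier with symbol `σ`. Linearity of `A` is not part
of the definition. -/
def IsFourierMultiplier {d : ℕ} (L : Submodule ℤ (EuclideanSpace ℝ (Fin d)))
    (Ω : Set (EuclideanSpace ℝ (Fin d))) (A : smoothPeriodic L → smoothPeriodic L)
    (σ : dualLattice L → ℂ) : Prop :=
  ∀ (f : smoothPeriodic L) (κ : dualLattice L),
    fourierCoef Ω (A f : EuclideanSpace ℝ (Fin d) → ℂ) κ =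
      σ κ * fourierCoef Ω (f : EuclideanSpace ℝ (Fin d) → ℂ) κ

/-- `sup_{s > 0} s (#{κ ∈ L^⊥ : |σ(κ)| ≥ s})^{1/p - 1/q}`, as an element of `[0, ∞]`. -/
def symbolSup {d : ℕ} {L : Submodule ℤ (EuclideanSpace ℝ (Fin d))} (σ : dualLattice L → ℂ)
    (p q : ℝ≥0∞) : ℝ≥0∞ :=
  ⨆ (s : ℝ) (_ : 0 < s),
    ENNReal.ofReal s * (({κ | s ≤ ‖σ κ‖}.encard : ℕ∞) : ℝ≥0∞) ^ (1 / p.toReal - 1 / q.toReal)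

/-- `sup_{f ≠ 0} ‖A f‖_{L^q(Ω)} / ‖f‖_{L^p(Ω)}` over `f ∈ C^∞(Ω)`, as an element of `[0, ∞]`. -/
def smoothOpNorm {d : ℕ} {L : Submodule ℤ (EuclideanSpace ℝ (Fin d))}
    (Ω : Set (EuclideanSpace ℝ (Fin d))) (A : smoothPeriodic L → smoothPeriodic L)
    (p q : ℝ≥0∞) : ℝ≥0∞ :=
  ⨆ (f : smoothPeriodic L) (_ : f ≠ 0),
    eLpNorm (A f : EuclideanSpace ℝ (Fin d) → ℂ) q (normMeasure Ω) /
      eLpNorm (f : EuclideanSpace ℝ (Fin d) → ℂ) p (normMeasure Ω)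

end LatticeFourier

end

open LatticeFourier

/-! The proof needs no interpolation theorem; it rests on duality, Cauchy–Schwarz and a weighted
form of Bessel's inequality of Paley type.

Write g = Af, h = |g|^(q-2) g, q' = q/(q-1), 1/r = 1/p - 1/q. Then ∫|g|^q is the pairing of g with
h, and Parseval bounds it by the sum of |σ| |f^| |h^| over the dual lattice. The hypothesis says
that u = |σ|/M lies in weak ℓ^r with constant 1. Split u into the powers u^(r(2-p)/(2p)) and
u^(r(2-q')/(2q')), whose exponents add up to 1 exactly because 1/r = 1/p + 1/q' - 1. Cauchy–Schwarz
then leaves two sums of the form ∑ v^(2-p) |f^|^2 with v = u^(r/p) in weak ℓ^p, one for (p, f) and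
one for (q', h). Each is at most a constant times the squared L^p (resp. L^q') norm
(`IsBesselSystem.tsum_rpow_mul_le`). Since ‖h‖_q' = ‖g‖_q^(q-1), division yields the estimate
(`IsParsevalSystem.lintegral_rpow_le`).

The weighted inequality is proved by hand. On the block of indices where v is about 2^(-j), cut f at
height 2^j. The bounded part is handled by Bessel, the rest by |f^| ≤ ‖f‖_1 and the size 2^(jp) of
the block. Summing over j under the integral gives two geometric series, both comparable to |f|^p.

All this uses only uniformly bounded kernels with Bessel and Parseval, hence constants independent
of the lattice. For a lattice, completeness of the exponentials is transported from the standard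
torus (`IsFundDomain.span_exp_closure_eq_top`). Density of smooth functions then gives the
extension. -/

namespace LatticeFourier

/-! ### Dyadic geometric sums -/

section WeightedBessel

theorem exists_le_two_pow {y : ℝ≥0∞} (hy : y ≠ ∞) : ∃ n : ℕ, y ≤ 2 ^ n := by
  lift y to ℝ≥0 using hy
  obtain ⟨n, hn⟩ := pow_unbounded_of_one_lt y (one_lt_two : (1 : ℝ≥0) < 2)
  exact ⟨n, by exact_mod_cast hn.le⟩

theorem two_pow_rpow (n : ℕ) (s : ℝ) : ((2 : ℝ≥0∞) ^ n) ^ s = ((2 : ℝ≥0∞) ^ s) ^ n := by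
  rw [← ENNReal.rpow_natCast, ← ENNReal.rpow_natCast, ← ENNReal.rpow_mul, ← ENNReal.rpow_mul,
    mul_comm]

/-- The sum of a decaying geometric sequence over the dyadic scales above `y` is comparable to its
value at `y`. -/
theorem tsum_two_pow_rpow_above_le {s : ℝ} (hs : 0 < s) {y : ℝ≥0∞} (hy : y ≠ ∞) :
    ∑' j : ℕ, (if y ≤ 2 ^ j then ((2 : ℝ≥0∞) ^ j) ^ (-s) else 0) ≤
      (1 - 2 ^ (-s))⁻¹ * y ^ (-s) := by
  classical
  have hex := exists_le_two_pow hy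
  -- The first dyadic scale reaching `y`: the sum is a geometric tail starting at `2 ^ m`, which is
  -- at least `y`.
  set m := Nat.find hex
  have hmy : y ≤ 2 ^ m := Nat.find_spec hex
  have hiff : ∀ j, y ≤ 2 ^ j ↔ m ≤ j := fun j =>
    ⟨fun h => Nat.find_min' hex h, fun h => hmy.trans (pow_le_pow_right₀ one_le_two h)⟩
  simp only [hiff]
  rw [← Summable.sum_add_tsum_nat_add' (k := m) ENNReal.summable]
  rw [Finset.sum_eq_zero (fun j hj => if_neg (not_le.2 (Finset.mem_range.1 hj))), zero_add]
  simp only [Nat.le_add_left, if_true, two_pow_rpow]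
  simp only [pow_add, ENNReal.tsum_mul_right, ENNReal.tsum_geometric]
  gcongr
  rw [← two_pow_rpow, ENNReal.rpow_neg, ENNReal.rpow_neg]
  gcongr

/-- The sum of a growing geometric sequence over the dyadic scales below `y` is comparable to its
value at `y`. -/
theorem tsum_two_pow_rpow_below_le {s : ℝ} (hs : 0 < s) {y : ℝ≥0∞} (hy : y ≠ ∞) :
    ∑' j : ℕ, (if 2 ^ j < y then ((2 : ℝ≥0∞) ^ j) ^ s else 0) ≤
      (1 - 2 ^ (-s))⁻¹ * y ^ s := by
  classical
  have hex := exists_le_two_pow hy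
  set m := Nat.find hex
  have hmy : y ≤ 2 ^ m := Nat.find_spec hex
  have hiff : ∀ j, 2 ^ j < y ↔ j < m := fun j =>
    ⟨fun h => by
      by_contra! hc
      exact absurd (hmy.trans (pow_le_pow_right₀ one_le_two hc)) (not_le.2 h),
     fun h => not_le.1 (Nat.find_min hex h)⟩
  simp only [hiff]
  -- Reversing the finite sum puts the largest term, at `2 ^ (m - 1) < y`, first; the others decay
  -- from it with ratio `2 ^ (-s)`.
  rw [tsum_eq_sum (s := Finset.range m) (fun j hj => if_neg (by simpa using hj)),
    Finset.sum_congr rfl (fun j hj => if_pos (Finset.mem_range.1 hj)),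
    ← Finset.sum_range_reflect]
  calc ∑ j ∈ Finset.range m, ((2 : ℝ≥0∞) ^ (m - 1 - j)) ^ s
      ≤ ∑ j ∈ Finset.range m, (2 ^ (-s)) ^ j * y ^ s := by
        refine Finset.sum_le_sum fun j hj => ?_
        have hj := Finset.mem_range.1 hj
        have h1 : ((2 : ℝ≥0∞) ^ (m - 1)) ^ s ≤ y ^ s :=
          ENNReal.rpow_le_rpow ((hiff _).2 (by omega)).le hs.le
        refine le_trans (le_of_eq ?_) (mul_le_mul_right h1 _)
        have : m - 1 = j + (m - 1 - j) := by omega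
        conv_rhs => rw [this]
        rw [two_pow_rpow, two_pow_rpow _ s, pow_add, ← mul_assoc, ← mul_pow,
          ← ENNReal.rpow_add _ _ (by simp) (by simp)]
        simp
    _ ≤ _ := by
        rw [← Finset.sum_mul, ← ENNReal.tsum_geometric]
        gcongr
        exact ENNReal.sum_le_tsum _

theorem one_sub_two_rpow_neg_inv_ne_top {s : ℝ} (hs : 0 < s) :
    ((1 : ℝ≥0∞) - 2 ^ (-s))⁻¹ ≠ ∞ := by
  have : (2 : ℝ≥0∞) ^ (-s) < 1 := ENNReal.rpow_lt_one_of_one_lt_of_neg (by simp) (by linarith)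
  simpa [tsub_eq_zero_iff_le] using this

/-! ### Bessel systems and the weighted Bessel inequality -/

variable {X ι : Type*} [MeasurableSpace X] {μ : Measure X} {k : ι → X → ℂ}

/-- A uniformly bounded system of kernels that satisfies Bessel's inequality. -/
structure IsBesselSystem (μ : Measure X) (k : ι → X → ℂ) : Prop where
  aestronglyMeasurable : ∀ i, AEStronglyMeasurable (k i) μ
  norm_le_one : ∀ i x, ‖k i x‖ ≤ 1
  bessel : ∀ g, MemLp g 2 μ →
    ∑' i, ‖∫ x, g x * k i x ∂μ‖ₑ ^ 2 ≤ ∫⁻ x, ‖g x‖ₑ ^ 2 ∂μ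

theorem IsBesselSystem.enorm_integral_le (hk : IsBesselSystem μ k) (g : X → ℂ) (i : ι) :
    ‖∫ x, g x * k i x ∂μ‖ₑ ≤ ∫⁻ x, ‖g x‖ₑ ∂μ := by
  refine (enorm_integral_le_lintegral_enorm _).trans (lintegral_mono fun x => ?_)
  rw [enorm_mul]
  refine mul_le_of_le_one_right' ?_
  rw [← ofReal_norm]
  exact ENNReal.ofReal_le_one.2 (hk.norm_le_one i x)

theorem IsBesselSystem.integrable_mul (hk : IsBesselSystem μ k) {g : X → ℂ} (hg : Integrable g μ)
    (i : ι) : Integrable (fun x => g x * k i x) μ :=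
  hg.mul_bdd (c := 1) (hk.aestronglyMeasurable i) (Filter.Eventually.of_forall (hk.norm_le_one i))

theorem add_sq_le_two_mul (a b : ℝ≥0∞) : (a + b) ^ 2 ≤ 2 * (a ^ 2 + b ^ 2) := by
  rcases eq_or_ne a ∞ with rfl | ha
  · simp
  rcases eq_or_ne b ∞ with rfl | hb
  · simp
  lift a to ℝ≥0 using ha
  lift b to ℝ≥0 using hb
  have := add_sq_le (a := a) (b := b)
  exact_mod_cast this

/-- The energy of the coefficients in a finite block, after cutting `f` at height `t`. -/
theorem IsBesselSystem.tsum_block_le [IsFiniteMeasure μ] (hk : IsBesselSystem μ k) {f : X → ℂ}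
    (hf : Measurable f) (hfi : Integrable f μ) (E : Set ι) (t : ℝ≥0) :
    ∑' i, E.indicator (fun i => ‖∫ x, f x * k i x ∂μ‖ₑ ^ 2) i ≤
      2 * (∫⁻ x, (if ‖f x‖ₑ ≤ t then ‖f x‖ₑ ^ 2 else 0) ∂μ +
        (E.encard : ℝ≥0∞) * (∫⁻ x, (if t < ‖f x‖ₑ then ‖f x‖ₑ else 0) ∂μ) ^ 2) := by
  classical
  set S : Set X := {x | ‖f x‖ₑ ≤ t}
  have hSm : MeasurableSet S := measurableSet_le hf.enorm measurable_const
  set g := S.indicator f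
  set h := Sᶜ.indicator f
  have hgb : MemLp g 2 μ := by
    refine MemLp.of_bound (hf.indicator hSm).aestronglyMeasurable t
      (Filter.Eventually.of_forall fun x => ?_)
    by_cases hx : x ∈ S
    · simp only [g, Set.indicator_of_mem hx]
      have : ‖f x‖ₑ ≤ t := hx
      rw [enorm_eq_nnnorm] at this
      exact_mod_cast this
    · simp [g, Set.indicator_of_notMem hx]
  have hsplit : ∀ i, ∫ x, f x * k i x ∂μ = ∫ x, g x * k i x ∂μ + ∫ x, h x * k i x ∂μ := by
    intro i
    rw [← integral_add (hk.integrable_mul (hfi.indicator hSm) i)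
      (hk.integrable_mul (hfi.indicator hSm.compl) i)]
    simp only [← add_mul]
    exact integral_congr_ae (Filter.Eventually.of_forall fun x => congrArg (· * k i x)
      (Set.indicator_self_add_compl_apply S f x).symm)
  have hg2 : ∫⁻ x, ‖g x‖ₑ ^ 2 ∂μ = ∫⁻ x, (if ‖f x‖ₑ ≤ t then ‖f x‖ₑ ^ 2 else 0) ∂μ := by
    congr 1 with x
    by_cases hx : ‖f x‖ₑ ≤ t
    · rw [if_pos hx, show g x = f x from Set.indicator_of_mem (s := S) hx f]
    · rw [if_neg hx, show g x = 0 from Set.indicator_of_notMem (s := S) hx f]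
      simp
  have hh1 : ∫⁻ x, ‖h x‖ₑ ∂μ = ∫⁻ x, (if t < ‖f x‖ₑ then ‖f x‖ₑ else 0) ∂μ := by
    congr 1 with x
    by_cases hx : t < ‖f x‖ₑ
    · rw [if_pos hx, show h x = f x from Set.indicator_of_mem (s := Sᶜ) (not_le.2 hx) f]
    · rw [if_neg hx, show h x = 0 from
        Set.indicator_of_notMem (s := Sᶜ) (fun hc => hc (not_lt.1 hx)) f]
      simp
  rw [← hg2, ← hh1]
  -- The bounded part `g` is in L² and is summed by Bessel over all indices; each coefficient of the
  -- tail `h` is at most its L¹ norm, and this is paid once for every element of `E`.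
  calc ∑' i, E.indicator (fun i => ‖∫ x, f x * k i x ∂μ‖ₑ ^ 2) i
      ≤ ∑' i, 2 * (‖∫ x, g x * k i x ∂μ‖ₑ ^ 2 +
          E.indicator (fun _ => (∫⁻ x, ‖h x‖ₑ ∂μ) ^ 2) i) := by
        refine ENNReal.tsum_le_tsum fun i => ?_
        by_cases hi : i ∈ E
        · simp only [Set.indicator_of_mem hi, hsplit]
          refine (pow_le_pow_left' (enorm_add_le _ _) 2).trans
            ((add_sq_le_two_mul _ _).trans ?_)
          gcongr
          exact hk.enorm_integral_le h i
        · simp [Set.indicator_of_notMem hi]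
    _ = 2 * (∑' i, ‖∫ x, g x * k i x ∂μ‖ₑ ^ 2 +
          (E.encard : ℝ≥0∞) * (∫⁻ x, ‖h x‖ₑ ∂μ) ^ 2) := by
        rw [ENNReal.tsum_mul_left, ENNReal.tsum_add, ← tsum_subtype E, ENNReal.tsum_const]
        rfl
    _ ≤ _ := by
        gcongr
        exact hk.bessel g hgb

/-- The constant in the weighted Bessel inequality for functions in `L^p`, `1 < p < 2`. -/
noncomputable def paleyConst (p : ℝ) : ℝ≥0∞ :=
  2 * ((1 - 2 ^ (-(2 - p)))⁻¹ + 2 ^ p * (1 - 2 ^ (-(p - 1)))⁻¹)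

theorem paleyConst_ne_top {p : ℝ} (hp1 : 1 < p) (hp2 : p < 2) : paleyConst p ≠ ∞ := by
  have h1 := one_sub_two_rpow_neg_inv_ne_top (s := 2 - p) (by linarith)
  have h2 := one_sub_two_rpow_neg_inv_ne_top (s := p - 1) (by linarith)
  have h3 : (2 : ℝ≥0∞) ^ p ≠ ∞ := ENNReal.rpow_ne_top_of_nonneg (by linarith) (by simp)
  exact ENNReal.mul_ne_top (by simp) (ENNReal.add_ne_top.2 ⟨h1, ENNReal.mul_ne_top h3 h2⟩)

/-- A nonempty set has at least one element, whereas `s ^ (-p) < 1` for `s > 1`. Hence only the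
dyadic scales `2⁻¹ ^ j` with `j ≥ 0` occur in the decomposition of a weight. -/
theorem le_one_of_encard_le_rpow {p : ℝ} (hp : 0 < p) {v : ι → ℝ≥0}
    (hv : ∀ s : ℝ≥0, 0 < s → (({i | s ≤ v i}.encard : ℕ∞) : ℝ≥0∞) ≤ (s : ℝ≥0∞) ^ (-p)) (i : ι) :
    v i ≤ 1 := by
  by_contra! hc
  have h1 := hv (v i) (one_pos.trans hc)
  have h2 : (1 : ℕ∞) ≤ {j | v i ≤ v j}.encard :=
    Set.one_le_encard_iff_nonempty.2 ⟨i, le_refl (v i)⟩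
  have h3 : ((v i : ℝ≥0) : ℝ≥0∞) ^ (-p) < 1 :=
    ENNReal.rpow_lt_one_of_one_lt_of_neg (by exact_mod_cast hc) (by linarith)
  have h4 : (1 : ℝ≥0∞) ≤ (({j | v i ≤ v j}.encard : ℕ∞) : ℝ≥0∞) := by exact_mod_cast h2
  exact absurd (h4.trans h1) (not_le.2 h3)

/-- The first moment above height `t` is controlled by the `p`-th moment. -/
theorem sq_lintegral_above_le {p : ℝ} (hp1 : 1 < p) {f : X → ℂ}
    (hfp : ∫⁻ x, ‖f x‖ₑ ^ p ∂μ ≤ 1) {t : ℝ≥0∞} (ht : t ≠ 0) (ht' : t ≠ ∞) :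
    (∫⁻ x, (if t < ‖f x‖ₑ then ‖f x‖ₑ else 0) ∂μ) ^ 2 ≤
      t ^ (1 - p) * ∫⁻ x, (if t < ‖f x‖ₑ then ‖f x‖ₑ else 0) ∂μ := by
  have h0 : t ^ (1 - p) ≠ ∞ := by
    simp [ENNReal.rpow_eq_top_iff, ht, ht']
  rw [sq]
  gcongr
  -- Only one of the two factors is estimated. The other stays linear in f, so that it can later be
  -- summed over the scales under the integral.
  calc ∫⁻ x, (if t < ‖f x‖ₑ then ‖f x‖ₑ else 0) ∂μ
      ≤ ∫⁻ x, t ^ (1 - p) * ‖f x‖ₑ ^ p ∂μ := by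
        refine lintegral_mono fun x => ?_
        split_ifs with hx
        · have hy0 : ‖f x‖ₑ ≠ 0 := (bot_le.trans_lt hx).ne'
          calc ‖f x‖ₑ = ‖f x‖ₑ ^ (1 - p) * ‖f x‖ₑ ^ p := by
                rw [← ENNReal.rpow_add _ _ hy0 enorm_ne_top]; simp
            _ ≤ _ := by
                gcongr ?_ * _
                rw [← neg_sub p 1, ENNReal.rpow_neg, ENNReal.rpow_neg]
                exact ENNReal.inv_le_inv.2 (ENNReal.rpow_le_rpow hx.le (by linarith))
        · exact zero_le
    _ ≤ t ^ (1 - p) := by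
        rw [lintegral_const_mul' _ _ h0]
        exact mul_le_of_le_one_right' hfp

/-- Weighted Bessel inequality, normalized: a weight in weak `ℓ^p`, raised to the power `2 - p`,
may be inserted into Bessel's inequality for functions in the unit ball of `L^p`. -/
theorem IsBesselSystem.tsum_rpow_mul_le_of_lintegral_le_one [IsFiniteMeasure μ]
    (hk : IsBesselSystem μ k) {p : ℝ} (hp1 : 1 < p) (hp2 : p < 2) {v : ι → ℝ≥0}
    (hv : ∀ s : ℝ≥0, 0 < s → (({i | s ≤ v i}.encard : ℕ∞) : ℝ≥0∞) ≤ (s : ℝ≥0∞) ^ (-p))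
    {f : X → ℂ} (hf : Measurable f) (hfi : Integrable f μ)
    (hfp : ∫⁻ x, ‖f x‖ₑ ^ p ∂μ ≤ 1) :
    ∑' i, (v i : ℝ≥0∞) ^ (2 - p) * ‖∫ x, f x * k i x ∂μ‖ₑ ^ 2 ≤ paleyConst p := by
  classical
  set c : ι → ℝ≥0∞ := fun i => ‖∫ x, f x * k i x ∂μ‖ₑ ^ 2
  set t : ℕ → ℝ≥0∞ := fun j => 2 ^ j
  have ht0 : ∀ j, t j ≠ 0 := fun j => by simp [t]
  have htt : ∀ j, t j ≠ ∞ := fun j => by simp [t]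
  -- On `E j` the weight is comparable to `(t j)⁻¹`, and f will be cut at the reciprocal height `t
  -- j`.
  set E : ℕ → Set ι := fun j => {i | (2⁻¹ : ℝ≥0) ^ (j + 1) < v i ∧ v i ≤ 2⁻¹ ^ j}
  have hcast : ∀ j : ℕ, (((2⁻¹ : ℝ≥0) ^ j : ℝ≥0) : ℝ≥0∞) = (t j)⁻¹ := fun j => by
    simp [t, ENNReal.inv_pow, ENNReal.coe_inv]
  have hcard : ∀ j, ((E j).encard : ℝ≥0∞) ≤ 2 ^ p * t j ^ p := by
    intro j
    have h1 := hv ((2⁻¹ : ℝ≥0) ^ (j + 1)) (by positivity)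
    rw [hcast, ENNReal.inv_rpow, ENNReal.rpow_neg, inv_inv] at h1
    have h2 : (E j).encard ≤ {i | (2⁻¹ : ℝ≥0) ^ (j + 1) ≤ v i}.encard :=
      Set.encard_le_encard fun i hi => hi.1.le
    have h3 : ((E j).encard : ℝ≥0∞) ≤
        (({i | (2⁻¹ : ℝ≥0) ^ (j + 1) ≤ v i}.encard : ℕ∞) : ℝ≥0∞) := by exact_mod_cast h2
    refine (h3.trans h1).trans (le_of_eq ?_)
    rw [← ENNReal.mul_rpow_of_nonneg _ _ (by linarith)]
    simp [t, pow_succ']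
  have hpt : ∀ i, (v i : ℝ≥0∞) ^ (2 - p) * c i ≤
      ∑' j, t j ^ (-(2 - p)) * (E j).indicator c i := by
    intro i
    rcases eq_or_ne (v i) 0 with h0 | h0
    · rw [h0, ENNReal.coe_zero, ENNReal.zero_rpow_of_pos (by linarith), zero_mul]
      exact zero_le
    · obtain ⟨j, hj1, hj2⟩ := exists_nat_pow_near_of_lt_one (pos_iff_ne_zero.2 h0)
        (le_one_of_encard_le_rpow (by linarith) hv i) (y := (2⁻¹ : ℝ≥0)) (by norm_num)
        (inv_lt_one_of_one_lt₀ one_lt_two)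
      refine le_trans ?_ (ENNReal.le_tsum j)
      rw [Set.indicator_of_mem (show i ∈ E j from ⟨hj1, hj2⟩)]
      gcongr
      rw [ENNReal.rpow_neg, ← ENNReal.inv_rpow, ← hcast]
      have : (v i : ℝ≥0∞) ≤ (((2⁻¹ : ℝ≥0) ^ j : ℝ≥0) : ℝ≥0∞) := by exact_mod_cast hj2
      exact ENNReal.rpow_le_rpow this (by linarith)
  -- The choice of the cut makes the powers balance: the low part carries t^(p-2), the high part
  -- t^(p-2) · t^p · t^(1-p) = t^(p-1).
  have hblock : ∀ j, t j ^ (-(2 - p)) * ∑' i, (E j).indicator c i ≤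
      2 * (∫⁻ x, (if ‖f x‖ₑ ≤ t j then t j ^ (-(2 - p)) else 0) * ‖f x‖ₑ ^ 2 ∂μ +
        2 ^ p * ∫⁻ x, (if t j < ‖f x‖ₑ then t j ^ (p - 1) else 0) * ‖f x‖ₑ ∂μ) := by
    intro j
    have h1 := hk.tsum_block_le hf hfi (E j) (2 ^ j)
    have hcj : (((2 : ℝ≥0) ^ j : ℝ≥0) : ℝ≥0∞) = t j := by simp [t]
    rw [hcj] at h1
    have hne : ∀ s : ℝ, t j ^ s ≠ ∞ := fun s => by simp [ENNReal.rpow_eq_top_iff, ht0, htt]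
    have e1 : ∫⁻ x, (if ‖f x‖ₑ ≤ t j then t j ^ (-(2 - p)) else 0) * ‖f x‖ₑ ^ 2 ∂μ =
        t j ^ (-(2 - p)) * ∫⁻ x, (if ‖f x‖ₑ ≤ t j then ‖f x‖ₑ ^ 2 else 0) ∂μ := by
      rw [← lintegral_const_mul' _ _ (hne _)]
      congr 1 with x
      split_ifs <;> simp
    have e2 : ∫⁻ x, (if t j < ‖f x‖ₑ then t j ^ (p - 1) else 0) * ‖f x‖ₑ ∂μ =
        t j ^ (p - 1) * ∫⁻ x, (if t j < ‖f x‖ₑ then ‖f x‖ₑ else 0) ∂μ := by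
      rw [← lintegral_const_mul' _ _ (hne _)]
      congr 1 with x
      split_ifs <;> simp
    rw [e1, e2]
    calc t j ^ (-(2 - p)) * ∑' i, (E j).indicator c i
        ≤ t j ^ (-(2 - p)) * (2 * (∫⁻ x, (if ‖f x‖ₑ ≤ t j then ‖f x‖ₑ ^ 2 else 0) ∂μ +
          (2 ^ p * t j ^ p) *
            (t j ^ (1 - p) * ∫⁻ x, (if t j < ‖f x‖ₑ then ‖f x‖ₑ else 0) ∂μ))) := by
          refine mul_le_mul_right (h1.trans ?_) _
          gcongr
          · exact hcard j
          · exact sq_lintegral_above_le hp1 hfp (ht0 j) (htt j)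
      _ = _ := by
          have : t j ^ (p - 1) = t j ^ (-(2 - p)) * t j ^ p * t j ^ (1 - p) := by
            rw [← ENNReal.rpow_add _ _ (ht0 j) (htt j), ← ENNReal.rpow_add _ _ (ht0 j) (htt j)]
            congr 1
            ring
          rw [this]
          ring
  have hm1 : ∀ j, Measurable fun x =>
      (if ‖f x‖ₑ ≤ t j then t j ^ (-(2 - p)) else 0) * ‖f x‖ₑ ^ 2 := fun j =>
    (Measurable.ite (measurableSet_le hf.enorm measurable_const) measurable_const
      measurable_const).mul (hf.enorm.pow_const 2)
  have hm2 : ∀ j, Measurable fun x =>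
      (if t j < ‖f x‖ₑ then t j ^ (p - 1) else 0) * ‖f x‖ₑ := fun j =>
    (Measurable.ite (measurableSet_lt measurable_const hf.enorm) measurable_const
      measurable_const).mul hf.enorm
  -- At each point the scales above |f(x)| sum to a multiple of |f(x)|^(p-2), which |f(x)|^2 turns
  -- into |f(x)|^p. This series converges because p < 2. Zeros of f are separated because the
  -- negative power is infinite there.
  have hlow : ∑' j, ∫⁻ x, (if ‖f x‖ₑ ≤ t j then t j ^ (-(2 - p)) else 0) * ‖f x‖ₑ ^ 2 ∂μ ≤
      (1 - 2 ^ (-(2 - p)))⁻¹ := by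
    rw [← lintegral_tsum fun j => (hm1 j).aemeasurable]
    calc _ ≤ ∫⁻ x, (1 - 2 ^ (-(2 - p)))⁻¹ * ‖f x‖ₑ ^ p ∂μ := by
          refine lintegral_mono fun x => ?_
          rw [ENNReal.tsum_mul_right]
          rcases eq_or_ne ‖f x‖ₑ 0 with h0 | h0
          · simp [h0]
          refine (mul_le_mul_left (tsum_two_pow_rpow_above_le (by linarith : 0 < 2 - p)
            enorm_ne_top) _).trans (le_of_eq ?_)
          rw [mul_assoc, ← ENNReal.rpow_natCast, ← ENNReal.rpow_add _ _ h0 enorm_ne_top]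
          congr 2
          push_cast
          ring
      _ ≤ _ := by
          rw [lintegral_const_mul' _ _ (one_sub_two_rpow_neg_inv_ne_top (by linarith))]
          exact mul_le_of_le_one_right' hfp
  -- Likewise the scales below |f(x)| sum to a multiple of |f(x)|^(p-1); here p > 1 is what makes
  -- the series geometric.
  have hhigh : ∑' j, ∫⁻ x, (if t j < ‖f x‖ₑ then t j ^ (p - 1) else 0) * ‖f x‖ₑ ∂μ ≤
      (1 - 2 ^ (-(p - 1)))⁻¹ := by
    rw [← lintegral_tsum fun j => (hm2 j).aemeasurable]
    calc _ ≤ ∫⁻ x, (1 - 2 ^ (-(p - 1)))⁻¹ * ‖f x‖ₑ ^ p ∂μ := by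
          refine lintegral_mono fun x => ?_
          rw [ENNReal.tsum_mul_right]
          rcases eq_or_ne ‖f x‖ₑ 0 with h0 | h0
          · simp [h0]
          refine (mul_le_mul_left (tsum_two_pow_rpow_below_le (by linarith : 0 < p - 1)
            enorm_ne_top) _).trans (le_of_eq ?_)
          rw [mul_assoc]
          nth_rewrite 2 [← ENNReal.rpow_one ‖f x‖ₑ]
          rw [← ENNReal.rpow_add _ _ h0 enorm_ne_top]
          congr 2
          ring
      _ ≤ _ := by
          rw [lintegral_const_mul' _ _ (one_sub_two_rpow_neg_inv_ne_top (by linarith))]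
          exact mul_le_of_le_one_right' hfp
  calc ∑' i, (v i : ℝ≥0∞) ^ (2 - p) * c i
      ≤ ∑' i, ∑' j, t j ^ (-(2 - p)) * (E j).indicator c i := ENNReal.tsum_le_tsum hpt
    _ = ∑' j, t j ^ (-(2 - p)) * ∑' i, (E j).indicator c i := by
        rw [ENNReal.tsum_comm]
        simp only [ENNReal.tsum_mul_left]
    _ ≤ _ := ENNReal.tsum_le_tsum hblock
    _ ≤ paleyConst p := by
        rw [ENNReal.tsum_mul_left, ENNReal.tsum_add, ENNReal.tsum_mul_left, paleyConst]
        gcongr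

/-- The constant in the weighted Bessel inequality for functions in `L^p`, `1 < p ≤ 2`. -/
noncomputable def besselConst (p : ℝ) : ℝ≥0∞ := if p < 2 then paleyConst p else 1

theorem besselConst_ne_top {p : ℝ} (hp1 : 1 < p) : besselConst p ≠ ∞ := by
  unfold besselConst
  split_ifs with h
  · exact paleyConst_ne_top hp1 h
  · simp

theorem lintegral_rpow_lt_top_of_memLp_two [IsFiniteMeasure μ] {p : ℝ} (hp1 : 1 < p) (hp2 : p ≤ 2)
    {f : X → ℂ} (hf2 : MemLp f 2 μ) : ∫⁻ x, ‖f x‖ₑ ^ p ∂μ < ∞ := by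
  have h1 : MemLp f (ENNReal.ofReal p) μ :=
    hf2.mono_exponent (by simpa using ENNReal.ofReal_le_ofReal hp2)
  have h2 := lintegral_rpow_enorm_lt_top_of_eLpNorm_lt_top (by simpa using by linarith) (by simp)
    h1.eLpNorm_lt_top
  rwa [ENNReal.toReal_ofReal (by linarith)] at h2

/-- Weighted Bessel inequality: a weight in weak `ℓ^p`, raised to the power `2 - p`, may be
inserted into Bessel's inequality for functions in `L^p`, `1 < p ≤ 2`. -/
theorem IsBesselSystem.tsum_rpow_mul_le [IsFiniteMeasure μ]
    (hk : IsBesselSystem μ k) {p : ℝ} (hp1 : 1 < p) (hp2 : p ≤ 2) {v : ι → ℝ≥0}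
    (hv : ∀ s : ℝ≥0, 0 < s → (({i | s ≤ v i}.encard : ℕ∞) : ℝ≥0∞) ≤ (s : ℝ≥0∞) ^ (-p))
    {f : X → ℂ} (hf : Measurable f) (hf2 : MemLp f 2 μ) :
    ∑' i, (v i : ℝ≥0∞) ^ (2 - p) * ‖∫ x, f x * k i x ∂μ‖ₑ ^ 2 ≤
      besselConst p * (∫⁻ x, ‖f x‖ₑ ^ p ∂μ) ^ (2 / p) := by
  have hp0 : 0 < p := by linarith
  rcases hp2.lt_or_eq with hp2' | rfl
  swap
  -- For p = 2 the weight has exponent 0 and this is plain Bessel.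
  · simpa [besselConst] using hk.bessel f hf2
  rw [besselConst, if_pos hp2']
  have hfin := (lintegral_rpow_lt_top_of_memLp_two hp1 hp2 hf2).ne
  rcases eq_or_ne (∫⁻ x, ‖f x‖ₑ ^ p ∂μ) 0 with h0 | h0
  · have hf0 : ∀ᵐ x ∂μ, f x = 0 := by
      rw [lintegral_eq_zero_iff (hf.enorm.pow_const p)] at h0
      filter_upwards [h0] with x hx
      simpa [hp0, hp0.not_gt] using hx
    have : ∀ i, ∫ x, f x * k i x ∂μ = 0 := fun i =>
      integral_eq_zero_of_ae (by filter_upwards [hf0] with x hx; simp [hx])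
    simp [this]
  set I := ∫⁻ x, ‖f x‖ₑ ^ p ∂μ with hI
  -- The reciprocal of the L^p norm of f: both sides are homogeneous of degree 2, so f may be scaled
  -- into the unit ball.
  set a : ℝ := (I ^ (-(1 / p))).toReal
  have hane : I ^ (-(1 / p)) ≠ ∞ := by simp [ENNReal.rpow_eq_top_iff, h0, hfin]
  have hae : ‖(a : ℂ)‖ₑ = I ^ (-(1 / p)) := by
    rw [← ofReal_norm, Complex.norm_real, Real.norm_of_nonneg ENNReal.toReal_nonneg,
      ENNReal.ofReal_toReal hane]
  have hnorm : ∫⁻ x, ‖(a : ℂ) * f x‖ₑ ^ p ∂μ ≤ 1 := by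
    simp only [enorm_mul, ENNReal.mul_rpow_of_nonneg _ _ hp0.le, hae]
    rw [lintegral_const_mul' _ _ (ENNReal.rpow_ne_top_of_nonneg hp0.le hane), ← ENNReal.rpow_mul,
      ← hI]
    have : -(1 / p) * p = -1 := by field_simp
    rw [this, ENNReal.rpow_neg_one, ENNReal.inv_mul_cancel h0 hfin]
  have hmain := hk.tsum_rpow_mul_le_of_lintegral_le_one hp1 hp2' hv (hf.const_mul (a : ℂ))
    ((hf2.integrable one_le_two).const_mul (a : ℂ)) hnorm
  simp only [mul_assoc, integral_const_mul, enorm_mul, hae, mul_pow] at hmain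
  have hsq : (I ^ (-(1 / p))) ^ 2 * I ^ (2 / p) = 1 := by
    rw [← ENNReal.rpow_natCast, ← ENNReal.rpow_mul, ← ENNReal.rpow_add _ _ h0 hfin]
    have : -(1 / p) * ((2 : ℕ) : ℝ) + 2 / p = 0 := by push_cast; ring
    rw [this, ENNReal.rpow_zero]
  calc ∑' i, (v i : ℝ≥0∞) ^ (2 - p) * ‖∫ x, f x * k i x ∂μ‖ₑ ^ 2
      = (∑' i, (v i : ℝ≥0∞) ^ (2 - p) *
          ((I ^ (-(1 / p))) ^ 2 * ‖∫ x, f x * k i x ∂μ‖ₑ ^ 2)) * I ^ (2 / p) := by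
        rw [← ENNReal.tsum_mul_right]
        refine tsum_congr fun i => ?_
        rw [← mul_one ((v i : ℝ≥0∞) ^ (2 - p) * ‖∫ x, f x * k i x ∂μ‖ₑ ^ 2), ← hsq]
        ring
    _ ≤ _ := by gcongr

/-! ### The bilinear estimate and duality -/

theorem tsum_mul_le_sqrt_mul_sqrt (a b : ι → ℝ≥0∞) :
    ∑' i, a i * b i ≤ (∑' i, a i ^ 2) ^ (1 / 2 : ℝ) * (∑' i, b i ^ 2) ^ (1 / 2 : ℝ) := by
  refine ENNReal.summable.tsum_le_of_sum_le fun s => ?_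
  refine (ENNReal.inner_le_Lp_mul_Lq s a b Real.HolderConjugate.two_two).trans ?_
  simp only [ENNReal.rpow_two]
  gcongr <;> exact ENNReal.sum_le_tsum s

/-- Bilinear form of the multiplier estimate for a weight in weak `ℓ^r`, normalized. -/
theorem IsBesselSystem.tsum_mul_mul_le [IsFiniteMeasure μ]
    (hk : IsBesselSystem μ k) {p p' r : ℝ} (hp1 : 1 < p) (hp2 : p ≤ 2) (hp1' : 1 < p')
    (hp2' : p' ≤ 2) (hr : 0 < r) (hrp : 1 / r = 1 / p + 1 / p' - 1) {u : ι → ℝ≥0}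
    (hu : ∀ s : ℝ≥0, 0 < s → (({i | s ≤ u i}.encard : ℕ∞) : ℝ≥0∞) ≤ (s : ℝ≥0∞) ^ (-r))
    {f h : X → ℂ} (hf : Measurable f) (hf2 : MemLp f 2 μ) (hh : Measurable h)
    (hh2 : MemLp h 2 μ) :
    ∑' i, u i * ‖∫ x, f x * k i x ∂μ‖ₑ * ‖∫ x, h x * k i x ∂μ‖ₑ ≤
      (besselConst p) ^ (1 / 2 : ℝ) * (besselConst p') ^ (1 / 2 : ℝ) *
      ((∫⁻ x, ‖f x‖ₑ ^ p ∂μ) ^ (1 / p) * (∫⁻ x, ‖h x‖ₑ ^ p' ∂μ) ^ (1 / p')) := by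
  -- A weight in weak ℓ^r, raised to the power r/p, is in weak ℓ^p with the same normalization.
  have hweak : ∀ p : ℝ, 1 < p → ∀ s : ℝ≥0, 0 < s →
      (({i | s ≤ u i ^ (r / p)}.encard : ℕ∞) : ℝ≥0∞) ≤ (s : ℝ≥0∞) ^ (-p) := by
    intro p hp s hs
    have hrp : 0 < r / p := by positivity
    have h1 := hu (s ^ (p / r)) (NNReal.rpow_pos hs)
    rw [ENNReal.coe_rpow_of_nonneg _ (by positivity), ← ENNReal.rpow_mul,
      show p / r * -r = -p by field_simp] at h1
    convert h1 using 5 with i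
    rw [← NNReal.rpow_le_rpow_iff hrp (x := s ^ (p / r)), ← NNReal.rpow_mul,
      show p / r * (r / p) = 1 by field_simp, NNReal.rpow_one]
  have key : ∀ p : ℝ, 1 < p → p ≤ 2 → ∀ f : X → ℂ, Measurable f → MemLp f 2 μ →
      (∑' i, ((u i : ℝ≥0∞) ^ (r / p * (2 - p) / 2) * ‖∫ x, f x * k i x ∂μ‖ₑ) ^ 2) ^ (1 / 2 : ℝ) ≤
      (besselConst p) ^ (1 / 2 : ℝ) * (∫⁻ x, ‖f x‖ₑ ^ p ∂μ) ^ (1 / p) := by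
    intro p hp1 hp2 f hf hf2
    have h1 := hk.tsum_rpow_mul_le hp1 hp2 (hweak p hp1) hf hf2
    have h2 := ENNReal.rpow_le_rpow h1 (by norm_num : (0 : ℝ) ≤ 1 / 2)
    rw [ENNReal.mul_rpow_of_nonneg _ _ (by norm_num : (0 : ℝ) ≤ 1 / 2), ← ENNReal.rpow_mul,
      show 2 / p * (1 / 2) = 1 / p by ring] at h2
    refine le_of_eq_of_le ?_ h2
    congr 2 with i
    rw [mul_pow, ENNReal.coe_rpow_of_nonneg _ (by positivity), ← ENNReal.rpow_natCast,
      ← ENNReal.rpow_mul, ← ENNReal.rpow_mul]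
    congr 2
    push_cast
    ring
  have hp0 : 0 < p := by linarith
  have hp0' : 0 < p' := by linarith
  have e1 : 0 ≤ r / p * (2 - p) / 2 :=
    div_nonneg (mul_nonneg (by positivity) (by linarith)) (by norm_num)
  have e2 : 0 ≤ r / p' * (2 - p') / 2 :=
    div_nonneg (mul_nonneg (by positivity) (by linarith)) (by norm_num)
  -- The relation between r, p and p' is exactly what lets the two Cauchy–Schwarz factors share the
  -- whole of `u`.
  have e3 : r / p * (2 - p) / 2 + r / p' * (2 - p') / 2 = 1 := by
    have : r / p * (2 - p) / 2 + r / p' * (2 - p') / 2 = r * (1 / p + 1 / p' - 1) := by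
      field_simp
      ring
    rw [this, ← hrp]
    field_simp
  calc ∑' i, (u i : ℝ≥0∞) * ‖∫ x, f x * k i x ∂μ‖ₑ * ‖∫ x, h x * k i x ∂μ‖ₑ
      = ∑' i, ((u i : ℝ≥0∞) ^ (r / p * (2 - p) / 2) * ‖∫ x, f x * k i x ∂μ‖ₑ) *
          ((u i : ℝ≥0∞) ^ (r / p' * (2 - p') / 2) * ‖∫ x, h x * k i x ∂μ‖ₑ) := by
        refine tsum_congr fun i => ?_
        nth_rewrite 1 [← ENNReal.rpow_one (u i : ℝ≥0∞)]
        rw [← e3, ENNReal.rpow_add_of_nonneg _ _ e1 e2]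
        ring
    _ ≤ _ := tsum_mul_le_sqrt_mul_sqrt _ _
    _ ≤ _ := mul_le_mul' (key p hp1 hp2 f hf hf2) (key p' hp1' hp2' h hh hh2)
    _ = _ := by ring

/-- A Bessel system for which the pairing of two functions is controlled by the pairing of their
coefficients. -/
structure IsParsevalSystem (μ : Measure X) (k : ι → X → ℂ) : Prop extends IsBesselSystem μ k where
  parseval : ∀ g h, MemLp g 2 μ → MemLp h 2 μ →
    ‖∫ x, g x * (starRingEnd ℂ) (h x) ∂μ‖ₑ ≤
      ∑' i, ‖∫ x, g x * k i x ∂μ‖ₑ * ‖∫ x, h x * k i x ∂μ‖ₑ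

/-- The division that closes the duality argument; it is legitimate only because `I` is known to be
finite beforehand. -/
theorem le_of_le_mul_rpow {I B : ℝ≥0∞} {q : ℝ} (hq : 1 < q) (hI : I ≠ ∞)
    (h : I ≤ B * I ^ (1 - 1 / q)) : I ^ (1 / q) ≤ B := by
  rcases eq_or_ne I 0 with h0 | h0
  · rw [h0, ENNReal.zero_rpow_of_pos (by positivity)]
    exact zero_le
  have h1 : I ^ (1 / q) * I ^ (1 - 1 / q) = I := by
    rw [← ENNReal.rpow_add _ _ h0 hI]; simp
  refine (ENNReal.mul_le_mul_iff_left ?_ ?_).1 (h1.le.trans h)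
  · simp [ENNReal.rpow_eq_zero_iff, h0, hI]
  · simp [ENNReal.rpow_eq_top_iff, h0, hI]

/-- The constant in the multiplier estimate. -/
noncomputable def multiplierConst (p q : ℝ) : ℝ≥0∞ :=
  (besselConst p) ^ (1 / 2 : ℝ) * (besselConst (q / (q - 1))) ^ (1 / 2 : ℝ)

/-- A multiplier whose symbol is dominated by a constant multiple of a normalized weak `ℓ^r`
weight is bounded from `L^p` to `L^q`. -/
theorem IsParsevalSystem.lintegral_rpow_le [IsFiniteMeasure μ]
    (hk : IsParsevalSystem μ k) {p q : ℝ} (hp1 : 1 < p) (hp2 : p ≤ 2) (hq2 : 2 ≤ q)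
    (hpq : 1 / q < 1 / p) {u : ι → ℝ≥0}
    (hu : ∀ s : ℝ≥0, 0 < s → (({i | s ≤ u i}.encard : ℕ∞) : ℝ≥0∞) ≤
      (s : ℝ≥0∞) ^ (-(1 / p - 1 / q)⁻¹))
    {f g : X → ℂ} (hf : Measurable f) (hf2 : MemLp f 2 μ) (hg : Measurable g)
    {b : ℝ} (hgb : ∀ x, ‖g x‖ ≤ b) {M : ℝ≥0∞}
    (hfg : ∀ i, ‖∫ x, g x * k i x ∂μ‖ₑ ≤ M * u i * ‖∫ x, f x * k i x ∂μ‖ₑ) :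
    (∫⁻ x, ‖g x‖ₑ ^ q ∂μ) ^ (1 / q) ≤
      multiplierConst p q * M * (∫⁻ x, ‖f x‖ₑ ^ p ∂μ) ^ (1 / p) := by
  have hq0 : 0 < q := by linarith
  -- The extremal function of Hölder's inequality: g times the conjugate of h is |g|^q, and
  -- |h|^(q/(q-1)) is again |g|^q.
  set h : X → ℂ := fun x => g x * ((‖g x‖ ^ (q - 2) : ℝ) : ℂ)
  have hhm : Measurable h :=
    hg.mul (Complex.measurable_ofReal.comp (hg.norm.pow_const (q - 2)))
  have hhnorm : ∀ x, ‖h x‖ = ‖g x‖ * ‖g x‖ ^ (q - 2) := fun x => by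
    simp only [h, norm_mul, Complex.norm_real]
    rw [Real.norm_of_nonneg (Real.rpow_nonneg (norm_nonneg _) _)]
  have hg2 : MemLp g 2 μ := MemLp.of_bound hg.aestronglyMeasurable b (.of_forall hgb)
  have hh2 : MemLp h 2 μ := by
    refine MemLp.of_bound hhm.aestronglyMeasurable (b * b ^ (q - 2)) (.of_forall fun x => ?_)
    have hb0 : 0 ≤ b := (norm_nonneg _).trans (hgb x)
    rw [hhnorm]
    exact mul_le_mul (hgb x) (Real.rpow_le_rpow (norm_nonneg _) (hgb x) (by linarith))
      (Real.rpow_nonneg (norm_nonneg _) _) hb0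
  have henorm : ∀ x, ‖h x‖ₑ = ‖g x‖ₑ ^ (q - 1) := fun x => by
    rw [← ofReal_norm, hhnorm, ENNReal.ofReal_mul (norm_nonneg _),
      ← ENNReal.ofReal_rpow_of_nonneg (norm_nonneg _) (by linarith), ofReal_norm]
    nth_rewrite 1 [← ENNReal.rpow_one ‖g x‖ₑ]
    rw [← ENNReal.rpow_add_of_nonneg _ _ (by norm_num) (by linarith)]
    congr 1
    ring
  have hpair : ‖∫ x, g x * (starRingEnd ℂ) (h x) ∂μ‖ₑ = ∫⁻ x, ‖g x‖ₑ ^ q ∂μ := by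
    have h1 : ∀ x, g x * (starRingEnd ℂ) (h x) = ((‖g x‖ ^ q : ℝ) : ℂ) := fun x => by
      simp only [h, map_mul, Complex.conj_ofReal, ← mul_assoc, Complex.mul_conj']
      norm_cast
      rw [← Real.rpow_natCast, ← Real.rpow_add_of_nonneg (norm_nonneg _) (by norm_num)
        (by linarith)]
      congr 1
      push_cast
      ring
    simp only [h1]
    rw [integral_complex_ofReal, ← ofReal_norm, Complex.norm_real, Real.norm_of_nonneg
      (integral_nonneg fun x => Real.rpow_nonneg (norm_nonneg _) _),
      ofReal_integral_eq_lintegral_ofReal]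
    · simp only [← ENNReal.ofReal_rpow_of_nonneg (norm_nonneg _) hq0.le, ofReal_norm]
    · refine Integrable.of_bound (hg.norm.pow_const q).aestronglyMeasurable (b ^ q)
        (.of_forall fun x => ?_)
      rw [Real.norm_of_nonneg (Real.rpow_nonneg (norm_nonneg _) _)]
      exact Real.rpow_le_rpow (norm_nonneg _) (hgb x) hq0.le
    · exact .of_forall fun x => Real.rpow_nonneg (norm_nonneg _) _
  set I := ∫⁻ x, ‖g x‖ₑ ^ q ∂μ with hI
  have hIfin : I ≠ ∞ := by
    rw [← hpair]
    exact enorm_ne_top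
  have hhI : ∫⁻ x, ‖h x‖ₑ ^ (q / (q - 1)) ∂μ = I := by
    have hq1 : q - 1 ≠ 0 := by linarith
    simp only [henorm, ← ENNReal.rpow_mul, mul_div_cancel₀ q hq1, hI]
  have hq'1 : 1 < q / (q - 1) := by rw [lt_div_iff₀ (by linarith)]; linarith
  have hq'2 : q / (q - 1) ≤ 2 := by rw [div_le_iff₀ (by linarith)]; linarith
  have hq'i : 1 / (q / (q - 1)) = 1 - 1 / q := by field_simp
  have hbil := hk.tsum_mul_mul_le hp1 hp2 hq'1 hq'2 (r := (1 / p - 1 / q)⁻¹)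
    (inv_pos.2 (by linarith)) (by rw [one_div, inv_inv, hq'i]; ring) hu hf hf2 hhm hh2
  rw [hhI, hq'i] at hbil
  refine le_of_le_mul_rpow (by linarith) hIfin ?_
  calc I ≤ ∑' i, ‖∫ x, g x * k i x ∂μ‖ₑ * ‖∫ x, h x * k i x ∂μ‖ₑ :=
        hpair ▸ hk.parseval g h hg2 hh2
    _ ≤ ∑' i, M * (u i * ‖∫ x, f x * k i x ∂μ‖ₑ * ‖∫ x, h x * k i x ∂μ‖ₑ) := by
        refine ENNReal.tsum_le_tsum fun i => ?_
        refine (mul_le_mul_left (hfg i) _).trans (le_of_eq ?_)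
        ring
    _ ≤ M * (multiplierConst p q *
          ((∫⁻ x, ‖f x‖ₑ ^ p ∂μ) ^ (1 / p) * I ^ (1 - 1 / q))) := by
        rw [ENNReal.tsum_mul_left]
        exact mul_le_mul_right hbil _
    _ = _ := by ring

end WeightedBessel

/-! ### Fundamental domains, characters and orthonormality -/

section Lattice

variable {d : ℕ} {L : Submodule ℤ (EuclideanSpace ℝ (Fin d))}
  {Ω : Set (EuclideanSpace ℝ (Fin d))}

theorem IsFundDomain.isAddFundamentalDomain (hΩ : IsFundDomain L Ω) :
    IsAddFundamentalDomain L Ω volume := by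
  refine IsAddFundamentalDomain.mk' hΩ.nullMeasurableSet fun x => ?_
  obtain ⟨l, ⟨hl, hx⟩, huniq⟩ := hΩ.existsUnique x
  refine ⟨⟨l, hl⟩, ?_, fun g hg => Subtype.ext (huniq g ⟨g.2, ?_⟩)⟩
  · simpa [Submodule.vadd_def, add_comm] using hx
  · simpa [Submodule.vadd_def, add_comm] using hg

theorem IsFundDomain.eq_of_sub_mem (hΩ : IsFundDomain L Ω) {x y : EuclideanSpace ℝ (Fin d)}
    (hx : x ∈ Ω) (hy : y ∈ Ω) (h : x - y ∈ L) : x = y := by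
  have := (hΩ.existsUnique y).unique ⟨h, by simpa using hx⟩ ⟨L.zero_mem, by simpa using hy⟩
  exact sub_eq_zero.1 this

theorem IsFundDomain.preimage_add_right (hΩ : IsFundDomain L Ω) (y : EuclideanSpace ℝ (Fin d)) :
    IsFundDomain L ((fun x => x + y) ⁻¹' Ω) where
  nullMeasurableSet := hΩ.nullMeasurableSet.preimage
    (measurePreserving_add_right volume y).quasiMeasurePreserving
  existsUnique x := by
    simpa only [Set.mem_preimage, add_right_comm] using hΩ.existsUnique (x + y)

instance vaddInvariantMeasure_lattice : VAddInvariantMeasure L (EuclideanSpace ℝ (Fin d)) volume :=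
  ⟨fun c _ _ => measure_preimage_add volume (c : EuclideanSpace ℝ (Fin d)) _⟩

/-- The kernel `e^{-2πi κ·x}` of the Fourier coefficient at `κ`. -/
noncomputable def fourierKernel (κ x : EuclideanSpace ℝ (Fin d)) : ℂ :=
  Complex.exp (-(2 * Real.pi * Complex.I * (inner ℝ κ x : ℝ)))

theorem contDiff_fourierKernel (κ : EuclideanSpace ℝ (Fin d)) :
    ContDiff ℝ ((⊤ : ℕ∞) : WithTop ℕ∞) (fourierKernel κ) := by
  unfold fourierKernel
  refine ContDiff.cexp (ContDiff.neg (contDiff_const.mul ?_))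
  exact Complex.ofRealCLM.contDiff.comp (contDiff_const.inner ℝ contDiff_id)

theorem fourierKernel_add_right (κ x y : EuclideanSpace ℝ (Fin d)) :
    fourierKernel κ (x + y) = fourierKernel κ x * fourierKernel κ y := by
  simp only [fourierKernel, inner_add_right, ← Complex.exp_add]
  congr 1
  push_cast
  ring

theorem fourierKernel_add_left (κ κ' x : EuclideanSpace ℝ (Fin d)) :
    fourierKernel (κ + κ') x = fourierKernel κ x * fourierKernel κ' x := by
  simp only [fourierKernel, inner_add_left, ← Complex.exp_add]
  congr 1
  push_cast
  ring

theorem conj_fourierKernel (κ x : EuclideanSpace ℝ (Fin d)) :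
    (starRingEnd ℂ) (fourierKernel κ x) = fourierKernel (-κ) x := by
  have h2 : (starRingEnd ℂ) (2 : ℂ) = 2 := Complex.conj_ofNat 2
  simp [fourierKernel, ← Complex.exp_conj, h2]

theorem norm_fourierKernel (κ x : EuclideanSpace ℝ (Fin d)) : ‖fourierKernel κ x‖ = 1 := by
  have : -(2 * Real.pi * Complex.I * (inner ℝ κ x : ℝ)) =
      ((-(2 * Real.pi * inner ℝ κ x) : ℝ) : ℂ) * Complex.I := by
    push_cast
    ring
  rw [fourierKernel, this, Complex.norm_exp_ofReal_mul_I]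

theorem fourierKernel_eq_one {κ l : EuclideanSpace ℝ (Fin d)} (hκ : κ ∈ dualLattice L)
    (hl : l ∈ L) : fourierKernel κ l = 1 := by
  obtain ⟨n, hn⟩ := mem_dualLattice.1 hκ l hl
  rw [fourierKernel, hn, Complex.exp_eq_one_iff]
  exact ⟨-n, by push_cast; ring⟩

theorem exists_fourierKernel_ne_one {κ : EuclideanSpace ℝ (Fin d)} (hκ : κ ≠ 0) :
    ∃ y, fourierKernel κ y ≠ 1 := by
  refine ⟨(1 / (2 * ‖κ‖ ^ 2)) • κ, ?_⟩
  have hn : ‖κ‖ ≠ 0 := norm_ne_zero_iff.2 hκ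
  have h1 : inner ℝ κ ((1 / (2 * ‖κ‖ ^ 2)) • κ) = 1 / 2 := by
    rw [inner_smul_right, real_inner_self_eq_norm_sq]
    field_simp
  rw [fourierKernel, h1]
  have : -(2 * Real.pi * Complex.I * ((1 / 2 : ℝ) : ℂ)) = -(Real.pi * Complex.I) := by
    push_cast
    ring
  rw [this, Complex.exp_neg, Complex.exp_pi_mul_I]
  norm_num

/-- The exponential `e^{2πi κ·x}`, `κ ∈ L^⊥`, as a smooth periodic function. -/
noncomputable def expPeriodic (κ : dualLattice L) : smoothPeriodic L :=
  ⟨fourierKernel (-(κ : EuclideanSpace ℝ (Fin d))), contDiff_fourierKernel _, fun x l hl => by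
    rw [fourierKernel_add_right, fourierKernel_eq_one (neg_mem κ.2) hl, mul_one]⟩

variable [DiscreteTopology L] [IsZLattice ℝ L]

theorem exists_bound_of_smoothPeriodic (f : smoothPeriodic L) :
    ∃ b : ℝ, ∀ x, ‖(f : EuclideanSpace ℝ (Fin d) → ℂ) x‖ ≤ b := by
  have h := IsZLattice.isCompact_range_of_periodic L (f : EuclideanSpace ℝ (Fin d) → ℂ)
    f.2.1.continuous f.2.2
  obtain ⟨b, hb⟩ := h.isBounded.exists_norm_le
  exact ⟨b, fun x => hb _ ⟨x, rfl⟩⟩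

/-- All fundamental domains have equal volume, so comparison with the parallelepiped of a basis
shows that `Ω`, though possibly unbounded, has positive finite measure. -/
theorem IsFundDomain.volume_eq (hΩ : IsFundDomain L Ω) {ι : Type*} [Finite ι]
    (b : Module.Basis ι ℤ L) :
    volume Ω = volume (ZSpan.fundamentalDomain (b.ofZLatticeBasis ℝ)) :=
  hΩ.isAddFundamentalDomain.measure_eq (ZLattice.isAddFundamentalDomain b volume)

theorem IsFundDomain.volume_ne_zero (hΩ : IsFundDomain L Ω) : volume Ω ≠ 0 := by
  have := ZLattice.module_free ℝ L
  have := ZLattice.module_finite ℝ L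
  rw [hΩ.volume_eq (Module.Free.chooseBasis ℤ L)]
  exact ZSpan.measure_fundamentalDomain_ne_zero _

theorem IsFundDomain.volume_ne_top (hΩ : IsFundDomain L Ω) : volume Ω ≠ ∞ := by
  have := ZLattice.module_free ℝ L
  have := ZLattice.module_finite ℝ L
  rw [hΩ.volume_eq (Module.Free.chooseBasis ℤ L)]
  exact (ZSpan.fundamentalDomain_isBounded _).measure_lt_top.ne

theorem IsFundDomain.isProbabilityMeasure (hΩ : IsFundDomain L Ω) :
    IsProbabilityMeasure (normMeasure Ω) :=
  ⟨by simp [normMeasure, ENNReal.inv_mul_cancel hΩ.volume_ne_zero hΩ.volume_ne_top]⟩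

/-- The translate of a fundamental domain is again one, and a periodic function has the same
integral over both. -/
theorem IsFundDomain.integral_add_right (hΩ : IsFundDomain L Ω)
    {F : EuclideanSpace ℝ (Fin d) → ℂ} (hF : ∀ x, ∀ l ∈ L, F (x + l) = F x)
    (y : EuclideanSpace ℝ (Fin d)) :
    ∫ x, F (x + y) ∂(normMeasure Ω) = ∫ x, F x ∂(normMeasure Ω) := by
  simp only [normMeasure, integral_smul_measure]
  congr 1
  rw [← (measurePreserving_add_right volume y).setIntegral_preimage_emb
    (measurableEmbedding_addRight y) F Ω]
  refine hΩ.isAddFundamentalDomain.setIntegral_eq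
    (hΩ.preimage_add_right y).isAddFundamentalDomain fun g x => ?_
  rw [Submodule.vadd_def, vadd_eq_add, add_comm (g : EuclideanSpace ℝ (Fin d)) x, add_right_comm,
    hF _ _ g.2]

/-- Translation by y preserves the integral but multiplies it by the value of the character at y,
which can be chosen different from 1. -/
theorem IsFundDomain.integral_fourierKernel (hΩ : IsFundDomain L Ω)
    {κ : EuclideanSpace ℝ (Fin d)} (hκ : κ ∈ dualLattice L) (h0 : κ ≠ 0) :
    ∫ x, fourierKernel κ x ∂(normMeasure Ω) = 0 := by
  obtain ⟨y, hy⟩ := exists_fourierKernel_ne_one h0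
  have h := hΩ.integral_add_right (F := fourierKernel κ)
    (fun x l hl => by rw [fourierKernel_add_right, fourierKernel_eq_one hκ hl, mul_one]) y
  simp only [fourierKernel_add_right, integral_mul_const] at h
  have h2 : (∫ x, fourierKernel κ x ∂(normMeasure Ω)) * (fourierKernel κ y - 1) = 0 := by
    rw [mul_sub, h, mul_one, sub_self]
  exact (mul_eq_zero.1 h2).resolve_right (sub_ne_zero.2 hy)

theorem IsFundDomain.memLp (hΩ : IsFundDomain L Ω) (p : ℝ≥0∞) (f : smoothPeriodic L) :
    MemLp (f : EuclideanSpace ℝ (Fin d) → ℂ) p (normMeasure Ω) := by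
  have := hΩ.isProbabilityMeasure
  obtain ⟨b, hb⟩ := exists_bound_of_smoothPeriodic f
  exact MemLp.of_bound f.2.1.continuous.aestronglyMeasurable b (.of_forall hb)

/-- The inclusion `C^∞(Ω) → L^p(Ω)`. -/
noncomputable def IsFundDomain.toLp (hΩ : IsFundDomain L Ω) (p : ℝ≥0∞) :
    smoothPeriodic L →ₗ[ℂ] Lp ℂ p (normMeasure Ω) where
  toFun f := (hΩ.memLp p f).toLp f
  map_add' f g := MemLp.toLp_add (hΩ.memLp p f) (hΩ.memLp p g)
  map_smul' c f := MemLp.toLp_const_smul c (hΩ.memLp p f)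

theorem inner_toLp_two {X : Type*} [MeasurableSpace X] {μ : Measure X} {f g : X → ℂ}
    (hf : MemLp f 2 μ) (hg : MemLp g 2 μ) :
    inner ℂ (hf.toLp f) (hg.toLp g) = ∫ x, g x * (starRingEnd ℂ) (f x) ∂μ := by
  rw [L2.inner_def]
  refine integral_congr_ae ?_
  filter_upwards [hf.coeFn_toLp, hg.coeFn_toLp] with x hx hy
  rw [hx, hy, RCLike.inner_apply]

theorem IsFundDomain.orthonormal_exp (hΩ : IsFundDomain L Ω) :
    Orthonormal ℂ fun κ : dualLattice L => hΩ.toLp 2 (expPeriodic κ) := by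
  classical
  have := hΩ.isProbabilityMeasure
  rw [orthonormal_iff_ite]
  intro κ κ'
  refine (inner_toLp_two (hΩ.memLp 2 (expPeriodic κ)) (hΩ.memLp 2 (expPeriodic κ'))).trans ?_
  have h1 : ∀ x, (expPeriodic κ' : EuclideanSpace ℝ (Fin d) → ℂ) x *
      (starRingEnd ℂ) ((expPeriodic κ : EuclideanSpace ℝ (Fin d) → ℂ) x) =
      fourierKernel ((κ - κ' : dualLattice L) : EuclideanSpace ℝ (Fin d)) x := fun x => by
    simp only [expPeriodic, conj_fourierKernel, neg_neg, ← fourierKernel_add_left]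
    congr 1
    rw [AddSubgroupClass.coe_sub]
    abel
  simp only [h1]
  split_ifs with h
  · simp [h, fourierKernel]
  · refine hΩ.integral_fourierKernel (κ - κ').2 ?_
    simpa [sub_eq_zero] using h

end Lattice

/-! ### Completeness of the exponentials, via the standard torus -/

section Density

variable {d : ℕ} {L : Submodule ℤ (EuclideanSpace ℝ (Fin d))}
  {Ω : Set (EuclideanSpace ℝ (Fin d))} [DiscreteTopology L] [IsZLattice ℝ L]
  {ι : Type*}

/-- The coordinates of a point with respect to a basis of `L`, modulo integers. -/
noncomputable def torusMap (b : Module.Basis ι ℤ L) (x : EuclideanSpace ℝ (Fin d)) :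
    UnitAddTorus ι :=
  fun i => (((b.ofZLatticeBasis ℝ L).repr x i : ℝ) : UnitAddCircle)

theorem continuous_torusMap (b : Module.Basis ι ℤ L) : Continuous (torusMap b) := by
  refine continuous_pi fun i => (AddCircle.continuous_mk' (1 : ℝ)).comp ?_
  exact ((b.ofZLatticeBasis ℝ L).coord i).continuous_of_finiteDimensional

theorem sub_mem_of_torusMap_eq (b : Module.Basis ι ℤ L) {x y : EuclideanSpace ℝ (Fin d)}
    (h : torusMap b x = torusMap b y) : x - y ∈ L := by
  rw [← b.ofZLatticeBasis_span ℝ, Module.Basis.mem_span_iff_repr_mem]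
  intro i
  have hi := congrFun h i
  rw [torusMap, torusMap, QuotientAddGroup.eq_iff_sub_mem, AddSubgroup.mem_zmultiples_iff] at hi
  obtain ⟨n, hn⟩ := hi
  exact ⟨n, by simpa using hn⟩

/-- The characters of the torus pull back to the exponentials `e^{2πi κ·x}`, `κ ∈ L^⊥`. -/
theorem exists_mFourier_torusMap [Fintype ι] (b : Module.Basis ι ℤ L) (n : ι → ℤ) :
    ∃ κ : dualLattice L, ∀ x,
      UnitAddTorus.mFourier n (torusMap b x) =
        (expPeriodic κ : EuclideanSpace ℝ (Fin d) → ℂ) x := by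
  set B := b.ofZLatticeBasis ℝ L
  let φ : EuclideanSpace ℝ (Fin d) →ₗ[ℝ] ℝ := ∑ i, (n i : ℝ) • B.coord i
  have hφ : ∀ x, φ x = ∑ i, (n i : ℝ) * B.repr x i := fun x => by simp [φ]
  -- The Riesz representative of the functional with integer coordinates `n` in the basis dual to
  -- `b`; integrality on the basis of L puts it in the dual lattice.
  let κ := (InnerProductSpace.toDual ℝ (EuclideanSpace ℝ (Fin d))).symm
    (LinearMap.toContinuousLinearMap φ)
  have hκ : ∀ x, inner ℝ κ x = ∑ i, (n i : ℝ) * B.repr x i := fun x => by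
    rw [← hφ]
    exact InnerProductSpace.toDual_symm_apply
  refine ⟨⟨κ, mem_dualLattice.2 fun l hl => ⟨∑ i, n i * b.repr ⟨l, hl⟩ i, ?_⟩⟩, fun x => ?_⟩
  · rw [hκ]
    push_cast
    refine Finset.sum_congr rfl fun i _ => ?_
    rw [← b.ofZLatticeBasis_repr_apply ℝ L ⟨l, hl⟩ i]
  · simp only [expPeriodic, fourierKernel, inner_neg_left, hκ, UnitAddTorus.mFourier,
      ContinuousMap.coe_mk, torusMap, fourier_coe_apply, ← Complex.exp_sum]
    congr 1
    push_cast
    rw [mul_neg, neg_neg, Finset.mul_sum]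
    exact Finset.sum_congr rfl fun i _ => by ring

/-- The torus map is injective on `Ω`, so every function on `Ω` factors through the torus;
measurability of the factor comes from the Lusin–Souslin theorem. Density results on the torus can
thus be pulled back to `Ω`. -/
theorem IsFundDomain.compMeasurePreserving_surjective [Countable ι] (hΩ : IsFundDomain L Ω) (p : ℝ≥0∞)
    (b : Module.Basis ι ℤ L)
    (hπ : MeasurePreserving (torusMap b) (normMeasure Ω) ((normMeasure Ω).map (torusMap b))) :
    Function.Surjective (Lp.compMeasurePreserving (E := ℂ) (p := p) (torusMap b) hπ) := by
  intro f
  -- `Ω` is only null measurable, while Lusin–Souslin needs a Borel set; a Borel subset of full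
  -- measure suffices.
  obtain ⟨S, hSΩ, hSm, hSae⟩ := hΩ.nullMeasurableSet.exists_measurable_subset_ae_eq
  have hemb : MeasurableEmbedding (S.domRestrict (torusMap b)) :=
    (continuous_torusMap b).continuousOn.measurableEmbedding hSm fun x hx y hy hxy =>
      hΩ.eq_of_sub_mem (hSΩ hx) (hSΩ hy) (sub_mem_of_torusMap_eq b hxy)
  obtain ⟨g, hg, hgf⟩ := hemb.exists_measurable_extend
    (g := fun x : S => f x) ((Lp.stronglyMeasurable f).measurable.comp measurable_subtype_coe)
    fun _ => ⟨0⟩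
  have hS : ∀ᵐ x ∂(normMeasure Ω), x ∈ S := by
    refine Measure.ae_smul_measure ?_ _
    rw [← Measure.restrict_congr_set hSae]
    exact ae_restrict_mem hSm
  have hae : g ∘ torusMap b =ᵐ[normMeasure Ω] f := by
    filter_upwards [hS] with x hx
    exact congrFun hgf ⟨x, hx⟩
  have hgLp : MemLp g p ((normMeasure Ω).map (torusMap b)) :=
    (memLp_map_measure_iff hg.aestronglyMeasurable
      (continuous_torusMap b).measurable.aemeasurable).2 ((memLp_congr_ae hae).2 (Lp.memLp f))
  refine ⟨hgLp.toLp g, ?_⟩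
  rw [Lp.toLp_compMeasurePreserving]
  refine Lp.ext ?_
  exact (MemLp.coeFn_toLp _).trans hae

/-- Trigonometric polynomials are dense in `L^p(Ω)`, `p < ∞`. -/
theorem IsFundDomain.span_exp_closure_eq_top (hΩ : IsFundDomain L Ω) {p : ℝ≥0∞} [Fact (1 ≤ p)]
    (hp : p ≠ ∞) :
    (Submodule.span ℂ (Set.range fun κ : dualLattice L =>
      hΩ.toLp p (expPeriodic κ))).topologicalClosure = ⊤ := by
  have := ZLattice.module_free ℝ L
  have := ZLattice.module_finite ℝ L
  have := hΩ.isProbabilityMeasure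
  let b := Module.Free.chooseBasis ℤ L
  have hπ : MeasurePreserving (torusMap b) (normMeasure Ω) ((normMeasure Ω).map (torusMap b)) :=
    (continuous_torusMap b).measurable.measurePreserving _
  have := Measure.isProbabilityMeasure_map (μ := normMeasure Ω)
    (continuous_torusMap b).measurable.aemeasurable
  let Φ : C(UnitAddTorus (Module.Free.ChooseBasisIndex ℤ L), ℂ) →L[ℂ] Lp ℂ p (normMeasure Ω) :=
    (Lp.compMeasurePreservingₗᵢ ℂ (torusMap b) hπ).toContinuousLinearMap.comp
      (ContinuousMap.toLp p ((normMeasure Ω).map (torusMap b)) ℂ)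
  have hΦ : DenseRange Φ := by
    have hsurj : Function.Surjective
        (Lp.compMeasurePreservingₗᵢ (E := ℂ) (p := p) ℂ (torusMap b) hπ) :=
      hΩ.compMeasurePreserving_surjective p b hπ
    exact hsurj.denseRange.comp
      (ContinuousMap.toLp_denseRange ℂ ((normMeasure Ω).map (torusMap b)) ℂ hp)
      (LinearIsometry.continuous _)
  -- The characters span a uniformly dense subspace of the continuous functions on the torus, and a
  -- continuous map with dense range keeps its image dense.
  have hcl := hΦ.topologicalClosure_map_submodule UnitAddTorus.span_mFourier_closure_eq_top
  rw [eq_top_iff, ← hcl]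
  refine Submodule.topologicalClosure_mono ?_
  rw [Submodule.map_span, Submodule.span_le]
  rintro _ ⟨_, ⟨n, rfl⟩, rfl⟩
  obtain ⟨κ, hκ⟩ := exists_mFourier_torusMap b n
  refine Submodule.subset_span ⟨κ, ?_⟩
  refine Lp.ext ?_
  refine (MemLp.coeFn_toLp (hΩ.memLp p (expPeriodic κ))).trans ?_
  refine Filter.EventuallyEq.trans ?_ (Lp.coeFn_compMeasurePreserving _ hπ).symm
  have h := hπ.quasiMeasurePreserving.ae_eq_comp (ContinuousMap.coeFn_toLp (p := p) (𝕜 := ℂ)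
    ((normMeasure Ω).map (torusMap b)) (UnitAddTorus.mFourier n))
  refine Filter.EventuallyEq.trans ?_ h.symm
  exact .of_forall fun x => (hκ x).symm

theorem IsFundDomain.denseRange_toLp (hΩ : IsFundDomain L Ω) {p : ℝ≥0∞} [Fact (1 ≤ p)]
    (hp : p ≠ ∞) : DenseRange (hΩ.toLp p) := by
  have h : ((LinearMap.range (hΩ.toLp p)).topologicalClosure) = ⊤ := by
    rw [eq_top_iff, ← hΩ.span_exp_closure_eq_top hp]
    refine Submodule.topologicalClosure_mono (Submodule.span_le.2 ?_)
    rintro _ ⟨κ, rfl⟩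
    exact ⟨expPeriodic κ, rfl⟩
  rw [DenseRange, ← LinearMap.coe_range]
  exact Submodule.dense_iff_topologicalClosure_eq_top.2 h

/-- The Fourier kernels of the dual lattice satisfy the Bessel and Parseval relations. -/
theorem IsFundDomain.isParsevalSystem (hΩ : IsFundDomain L Ω) :
    IsParsevalSystem (normMeasure Ω)
      (fun κ : dualLattice L => fourierKernel (κ : EuclideanSpace ℝ (Fin d))) := by
  have := hΩ.isProbabilityMeasure
  have hexp : ∀ (κ : dualLattice L) (x : EuclideanSpace ℝ (Fin d)),
      (starRingEnd ℂ) ((expPeriodic κ : EuclideanSpace ℝ (Fin d) → ℂ) x) =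
        fourierKernel (κ : EuclideanSpace ℝ (Fin d)) x := fun κ x => by
    simp only [expPeriodic, conj_fourierKernel, neg_neg]
  have hcoef : ∀ (κ : dualLattice L) (g : EuclideanSpace ℝ (Fin d) → ℂ)
      (hg : MemLp g 2 (normMeasure Ω)),
      inner ℂ (hΩ.toLp 2 (expPeriodic κ)) (hg.toLp g) =
        ∫ x, g x * fourierKernel (κ : EuclideanSpace ℝ (Fin d)) x ∂(normMeasure Ω) :=
    fun κ g hg => by
      refine (inner_toLp_two (hΩ.memLp 2 (expPeriodic κ)) hg).trans ?_
      simp only [hexp]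
  refine ⟨⟨fun κ => (contDiff_fourierKernel _).continuous.aestronglyMeasurable,
    fun κ x => (norm_fourierKernel _ _).le, fun g hg => ?_⟩, fun g h hg hh => ?_⟩
  · simp only [← hcoef _ g hg]
    have hn : ∫⁻ x, ‖g x‖ₑ ^ 2 ∂(normMeasure Ω) = ‖hg.toLp g‖ₑ ^ 2 := by
      rw [Lp.enorm_toLp, eLpNorm_eq_lintegral_rpow_enorm_toReal (by simp) (by simp),
        ← ENNReal.rpow_natCast, ← ENNReal.rpow_mul]
      simp
    rw [hn]
    refine ENNReal.summable.tsum_le_of_sum_le fun s => ?_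
    have := hΩ.orthonormal_exp.sum_inner_products_le (hg.toLp g) (s := s)
    have h2 := ENNReal.ofReal_le_ofReal this
    rw [ENNReal.ofReal_sum_of_nonneg fun i _ => by positivity] at h2
    simpa only [ENNReal.ofReal_pow (norm_nonneg _), ofReal_norm] using h2
  -- Density in L² upgrades the orthonormal family to a Hilbert basis; the triangle inequality
  -- applied to the Parseval sum gives the required bound.
  · let e := HilbertBasis.mk hΩ.orthonormal_exp
      (hΩ.span_exp_closure_eq_top (p := 2) (by simp)).ge
    have hs := e.hasSum_inner_mul_inner (hh.toLp h) (hg.toLp g)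
    rw [inner_toLp_two hh hg] at hs
    rw [← hs.tsum_eq]
    refine enorm_tsum_le_tsum_enorm.trans (ENNReal.tsum_le_tsum fun κ => le_of_eq ?_)
    rw [enorm_mul, mul_comm, HilbertBasis.coe_mk, ← inner_conj_symm (hh.toLp h), hcoef κ g hg,
      hcoef κ h hh]
    congr 1
    simp [← ofReal_norm]

end Density

/-! ### Fourier multipliers on the lattice -/

section Multiplier

/-- Pairing g with itself gives zero L² norm. This uniqueness serves twice: when the symbol
vanishes, and for the linearity of A modulo null sets. -/
theorem IsParsevalSystem.ae_eq_zero {X ι : Type*} [MeasurableSpace X] {μ : Measure X}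
    {k : ι → X → ℂ} (hk : IsParsevalSystem μ k) {g : X → ℂ} (hg : MemLp g 2 μ)
    (h0 : ∀ i, ∫ x, g x * k i x ∂μ = 0) : g =ᵐ[μ] 0 := by
  have h := hk.parseval g g hg hg
  simp only [h0, enorm_zero, mul_zero, tsum_zero, nonpos_iff_eq_zero, enorm_eq_zero] at h
  rw [← inner_toLp_two hg hg, inner_self_eq_zero] at h
  have h1 := hg.coeFn_toLp
  rw [h] at h1
  exact h1.symm.trans (Lp.coeFn_zero _ _ _)

variable {d : ℕ} {L : Submodule ℤ (EuclideanSpace ℝ (Fin d))}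
  {Ω : Set (EuclideanSpace ℝ (Fin d))} {A : smoothPeriodic L → smoothPeriodic L}
  {σ : dualLattice L → ℂ} {p q : ℝ≥0∞}

theorem eq_zero_of_symbolSup_eq_zero (hpq : 0 < 1 / p.toReal - 1 / q.toReal)
    (h : symbolSup σ p q = 0) (κ : dualLattice L) : σ κ = 0 := by
  by_contra hκ
  have hs : 0 < ‖σ κ‖ := norm_pos_iff.2 hκ
  have h1 := ENNReal.iSup_eq_zero.1 (ENNReal.iSup_eq_zero.1 h ‖σ κ‖) hs
  rcases mul_eq_zero.1 h1 with h2 | h2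
  · exact absurd (ENNReal.ofReal_eq_zero.1 h2) (not_le.2 hs)
  · rw [ENNReal.rpow_eq_zero_iff_of_pos hpq] at h2
    have h3 : {κ' | ‖σ κ‖ ≤ ‖σ κ'‖}.encard = 0 := by exact_mod_cast h2
    exact (Set.encard_ne_zero.2 ⟨κ, le_refl ‖σ κ‖⟩) h3

/-- The supremum evaluated at height s·M, solved for the cardinality: division by M normalizes the
symbol to a weak ℓ^r weight of constant 1. -/
theorem encard_le_of_symbolSup (hpq : 0 < 1 / p.toReal - 1 / q.toReal)
    (h0 : symbolSup σ p q ≠ 0) (hfin : symbolSup σ p q ≠ ∞) {s : ℝ≥0} (hs : 0 < s) :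
    (({κ | s ≤ ‖σ κ‖₊ / (symbolSup σ p q).toNNReal}.encard : ℕ∞) : ℝ≥0∞) ≤
      (s : ℝ≥0∞) ^ (-(1 / p.toReal - 1 / q.toReal)⁻¹) := by
  set δ := 1 / p.toReal - 1 / q.toReal
  set M := symbolSup σ p q
  have hMpos : 0 < M.toNNReal := ENNReal.toNNReal_pos h0 hfin
  have h1 : ENNReal.ofReal (s * M.toNNReal : ℝ≥0) *
      (({κ | ((s * M.toNNReal : ℝ≥0) : ℝ) ≤ ‖σ κ‖}.encard : ℕ∞) : ℝ≥0∞) ^ δ ≤ M :=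
    le_iSup₂_of_le (f := fun (s : ℝ) (_ : 0 < s) => ENNReal.ofReal s *
      (({κ | s ≤ ‖σ κ‖}.encard : ℕ∞) : ℝ≥0∞) ^ δ) ((s * M.toNNReal : ℝ≥0) : ℝ)
      (by positivity) le_rfl
  have hset : {κ | ((s * M.toNNReal : ℝ≥0) : ℝ) ≤ ‖σ κ‖} =
      {κ | s ≤ ‖σ κ‖₊ / M.toNNReal} := by
    ext κ
    simp only [Set.mem_ofPred_eq, le_div_iff₀ hMpos]
    rw [← coe_nnnorm, NNReal.coe_le_coe]
  rw [hset, ENNReal.ofReal_coe_nnreal, ENNReal.coe_mul, ENNReal.coe_toNNReal hfin] at h1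
  set N : ℝ≥0∞ := (({κ | s ≤ ‖σ κ‖₊ / M.toNNReal}.encard : ℕ∞) : ℝ≥0∞)
  have h2 : (s : ℝ≥0∞) * N ^ δ ≤ 1 := by
    rw [mul_right_comm] at h1
    exact (ENNReal.mul_le_mul_iff_left h0 hfin).1 (by simpa using h1)
  have h3 : N ^ δ ≤ (s : ℝ≥0∞)⁻¹ := by
    rw [ENNReal.le_inv_iff_mul_le, mul_comm]
    exact h2
  calc N = (N ^ δ) ^ δ⁻¹ := by rw [← ENNReal.rpow_mul, mul_inv_cancel₀ hpq.ne', ENNReal.rpow_one]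
    _ ≤ ((s : ℝ≥0∞)⁻¹) ^ δ⁻¹ := ENNReal.rpow_le_rpow h3 (inv_nonneg.2 hpq.le)
    _ = _ := by rw [ENNReal.inv_rpow, ENNReal.rpow_neg]

theorem one_div_toReal_lt (hp1 : 1 < p) (hp2 : p ≤ 2) (hq2 : 2 ≤ q) (hq : q < ∞)
    (hpq : ¬(p = 2 ∧ q = 2)) : 1 / q.toReal < 1 / p.toReal := by
  have hlt : p < q := by
    rcases (hp2.trans hq2).lt_or_eq with h | h
    · exact h
    · exact absurd ⟨le_antisymm hp2 (h ▸ hq2), le_antisymm (h ▸ hp2) hq2⟩ hpq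
  have hp0 : 0 < p.toReal := ENNReal.toReal_pos (one_pos.trans hp1).ne' (hlt.trans hq).ne
  exact one_div_lt_one_div_of_lt hp0 ((ENNReal.toReal_lt_toReal (hlt.trans hq).ne hq.ne).2 hlt)

variable [DiscreteTopology L] [IsZLattice ℝ L]

/-- The multiplier estimate on smooth functions. -/
theorem IsFourierMultiplier.eLpNorm_le (hΩ : IsFundDomain L Ω) (hA : IsFourierMultiplier L Ω A σ)
    (hp1 : 1 < p) (hp2 : p ≤ 2) (hq2 : 2 ≤ q) (hq : q < ∞) (hpq : ¬(p = 2 ∧ q = 2))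
    (hfin : symbolSup σ p q < ∞) (f : smoothPeriodic L) :
    eLpNorm (A f : EuclideanSpace ℝ (Fin d) → ℂ) q (normMeasure Ω) ≤
      multiplierConst p.toReal q.toReal * symbolSup σ p q *
        eLpNorm (f : EuclideanSpace ℝ (Fin d) → ℂ) p (normMeasure Ω) := by
  have := hΩ.isProbabilityMeasure
  have hpt : p ≠ ∞ := (hp2.trans_lt (by simp)).ne
  have hlt := one_div_toReal_lt hp1 hp2 hq2 hq hpq
  have hδ : 0 < 1 / p.toReal - 1 / q.toReal := by linarith
  have hA' : ∀ κ : dualLattice L,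
      ∫ x, (A f : EuclideanSpace ℝ (Fin d) → ℂ) x *
        fourierKernel (κ : EuclideanSpace ℝ (Fin d)) x ∂(normMeasure Ω) =
      σ κ * ∫ x, (f : EuclideanSpace ℝ (Fin d) → ℂ) x *
        fourierKernel (κ : EuclideanSpace ℝ (Fin d)) x ∂(normMeasure Ω) := hA f
  -- The symbol cannot be normalized when M = 0; then σ vanishes identically and so does Af almost
  -- everywhere.
  rcases eq_or_ne (symbolSup σ p q) 0 with h0 | h0
  · have hσ := eq_zero_of_symbolSup_eq_zero hδ h0
    have hAf : (A f : EuclideanSpace ℝ (Fin d) → ℂ) =ᵐ[normMeasure Ω] 0 :=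
      hΩ.isParsevalSystem.ae_eq_zero (hΩ.memLp 2 (A f)) fun κ => by rw [hA', hσ, zero_mul]
    rw [eLpNorm_congr_ae hAf, eLpNorm_zero]
    exact zero_le
  obtain ⟨b, hb⟩ := exists_bound_of_smoothPeriodic (A f)
  rw [eLpNorm_eq_lintegral_rpow_enorm_toReal (one_pos.trans hp1).ne' hpt,
    eLpNorm_eq_lintegral_rpow_enorm_toReal (two_pos.trans_le hq2).ne' hq.ne]
  refine hΩ.isParsevalSystem.lintegral_rpow_le
    (by simpa using (ENNReal.toReal_lt_toReal (by simp) hpt).2 hp1)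
    (by simpa using (ENNReal.toReal_le_toReal hpt (by simp)).2 hp2)
    (by simpa using (ENNReal.toReal_le_toReal (by simp) hq.ne).2 hq2) hlt
    (fun s hs => encard_le_of_symbolSup hδ h0 hfin.ne hs)
    f.2.1.continuous.measurable (hΩ.memLp 2 f) (A f).2.1.continuous.measurable hb fun κ => ?_
  rw [hA', enorm_mul]
  gcongr
  have hM : (symbolSup σ p q).toNNReal ≠ 0 := (ENNReal.toNNReal_pos h0 hfin.ne).ne'
  rw [ENNReal.coe_div hM, ENNReal.coe_toNNReal hfin.ne, ENNReal.mul_div_cancel h0 hfin.ne]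
  rfl

/-- A Fourier multiplier is linear modulo null sets. -/
theorem IsFourierMultiplier.exists_linearMap (hΩ : IsFundDomain L Ω)
    (hA : IsFourierMultiplier L Ω A σ) (q : ℝ≥0∞) :
    ∃ F : smoothPeriodic L →ₗ[ℂ] Lp ℂ q (normMeasure Ω), ∀ f, F f = hΩ.toLp q (A f) := by
  have := hΩ.isProbabilityMeasure
  have hk := hΩ.isParsevalSystem
  have hintegrable : ∀ (f : smoothPeriodic L) (κ : dualLattice L), Integrable (fun x =>
      (f : EuclideanSpace ℝ (Fin d) → ℂ) x * fourierKernel (κ : EuclideanSpace ℝ (Fin d)) x)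
      (normMeasure Ω) := fun f κ => hk.integrable_mul ((hΩ.memLp 1 f).integrable le_rfl) κ
  have hadd : ∀ (f g : smoothPeriodic L) (κ : dualLattice L),
      fourierCoef Ω (f + g : smoothPeriodic L) κ = fourierCoef Ω f κ + fourierCoef Ω g κ :=
    fun f g κ => by
      refine Eq.trans ?_ (integral_add (hintegrable f κ) (hintegrable g κ))
      exact integral_congr_ae (.of_forall fun x => add_mul _ _ _)
  have hsmul : ∀ (c : ℂ) (f : smoothPeriodic L) (κ : dualLattice L),
      fourierCoef Ω (c • f : smoothPeriodic L) κ = c * fourierCoef Ω f κ :=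
    fun c f κ => by
      refine Eq.trans ?_ (integral_const_mul c _)
      exact integral_congr_ae (.of_forall fun x => mul_assoc _ _ _)
  -- Linearity of A is not assumed; it follows because the Fourier coefficients determine a smooth
  -- function almost everywhere and depend linearly on it.
  have hext : ∀ f g : smoothPeriodic L, (∀ κ : dualLattice L, fourierCoef Ω f κ =
      fourierCoef Ω g κ) → hΩ.toLp q f = hΩ.toLp q g := by
    intro f g h
    have hz : ((f + (-1 : ℂ) • g : smoothPeriodic L) : EuclideanSpace ℝ (Fin d) → ℂ)
        =ᵐ[normMeasure Ω] 0 := by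
      refine hk.ae_eq_zero (hΩ.memLp 2 _) fun κ => ?_
      have h1 : fourierCoef Ω (f + (-1 : ℂ) • g : smoothPeriodic L) κ = 0 := by
        rw [hadd, hsmul, h]
        ring
      exact h1
    refine (MemLp.toLp_eq_toLp_iff (hΩ.memLp q f) (hΩ.memLp q g)).2 ?_
    filter_upwards [hz] with x hx
    have hx' : (f : EuclideanSpace ℝ (Fin d) → ℂ) x +
      (-1 : ℂ) * (g : EuclideanSpace ℝ (Fin d) → ℂ) x = 0 := hx
    linear_combination hx'
  refine ⟨{ toFun := fun f => hΩ.toLp q (A f), map_add' := fun f g => ?_,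
            map_smul' := fun c f => ?_ }, fun f => rfl⟩
  · rw [← map_add]
    refine hext _ _ fun κ => ?_
    rw [hadd, hA, hA, hA, hadd, mul_add]
  · rw [RingHom.id_apply, ← map_smul]
    refine hext _ _ fun κ => ?_
    rw [hsmul, hA, hA, hsmul]
    ring

theorem multiplierConst_ne_top {p q : ℝ} (hp1 : 1 < p) (hq2 : 2 ≤ q) :
    multiplierConst p q ≠ ∞ := by
  have hq' : 1 < q / (q - 1) := by rw [lt_div_iff₀ (by linarith)]; linarith
  exact ENNReal.mul_ne_top
    (ENNReal.rpow_ne_top_of_nonneg (by norm_num) (besselConst_ne_top hp1))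
    (ENNReal.rpow_ne_top_of_nonneg (by norm_num) (besselConst_ne_top hq'))

end Multiplier

end LatticeFourier

/-! ### The operator bound and the extension to L^p -/

theorem mainTheorem1 (p q : ℝ≥0∞) [Fact (1 ≤ p)] [Fact (1 ≤ q)]
    (hp1 : 1 < p) (hp2 : p ≤ 2) (hq2 : 2 ≤ q) (hq : q < ∞) (hpq : ¬(p = 2 ∧ q = 2)) :
    ∃ C : ℝ≥0, 0 < C ∧
      ∀ (d : ℕ) (L : Submodule ℤ (EuclideanSpace ℝ (Fin d)))
        [DiscreteTopology L] [IsZLattice ℝ L]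
        (Ω : Set (EuclideanSpace ℝ (Fin d))) (_ : IsFundDomain L Ω)
        (A : smoothPeriodic L → smoothPeriodic L) (σ : dualLattice L → ℂ)
        (_ : IsFourierMultiplier L Ω A σ) (_ : symbolSup σ p q < ∞),
        smoothOpNorm Ω A p q ≤ C * symbolSup σ p q ∧
        ∃ T : Lp ℂ p (normMeasure Ω) →L[ℂ] Lp ℂ q (normMeasure Ω),
          (∀ f : smoothPeriodic L,
            ∃ (hf : MemLp (f : EuclideanSpace ℝ (Fin d) → ℂ) p (normMeasure Ω))
              (hAf : MemLp (A f : EuclideanSpace ℝ (Fin d) → ℂ) q (normMeasure Ω)),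
              T (hf.toLp f) = hAf.toLp (A f)) ∧
          ‖T‖ ≤ C * (symbolSup σ p q).toReal := by
  have hpt : p ≠ ∞ := (hp2.trans_lt (by simp)).ne
  have hK : multiplierConst p.toReal q.toReal ≠ ∞ := multiplierConst_ne_top
    (by simpa using (ENNReal.toReal_lt_toReal (by simp) hpt).2 hp1)
    (by simpa using (ENNReal.toReal_le_toReal (by simp) hq.ne).2 hq2)
  -- The added 1 only serves to make the constant visibly positive.
  set C : ℝ≥0 := (multiplierConst p.toReal q.toReal).toNNReal + 1 with hC
  have hKC : multiplierConst p.toReal q.toReal ≤ C := by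
    rw [hC, ENNReal.coe_add, ENNReal.coe_toNNReal hK]
    exact le_self_add
  refine ⟨C, by positivity, fun d L _ _ Ω hΩ A σ hA hfin => ?_⟩
  have hbound : ∀ f : smoothPeriodic L,
      eLpNorm (A f : EuclideanSpace ℝ (Fin d) → ℂ) q (normMeasure Ω) ≤
        C * symbolSup σ p q * eLpNorm (f : EuclideanSpace ℝ (Fin d) → ℂ) p (normMeasure Ω) :=
    fun f => (hA.eLpNorm_le hΩ hp1 hp2 hq2 hq hpq hfin f).trans (by gcongr)
  refine ⟨iSup₂_le fun f _ => ENNReal.div_le_of_le_mul (hbound f), ?_⟩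
  obtain ⟨F, hF⟩ := hA.exists_linearMap hΩ q
  have hdense : DenseRange (hΩ.toLp p) := hΩ.denseRange_toLp hpt
  have hnorm : ∀ f, ‖F f‖ ≤ (C * (symbolSup σ p q).toReal) * ‖hΩ.toLp p f‖ := by
    intro f
    rw [hF]
    have h1 : ‖hΩ.toLp q (A f)‖ = (eLpNorm (A f : EuclideanSpace ℝ (Fin d) → ℂ) q
        (normMeasure Ω)).toReal := Lp.norm_toLp _ (hΩ.memLp q (A f))
    have h2 : ‖hΩ.toLp p f‖ = (eLpNorm (f : EuclideanSpace ℝ (Fin d) → ℂ) p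
        (normMeasure Ω)).toReal := Lp.norm_toLp _ (hΩ.memLp p f)
    rw [h1, h2]
    have h3 := ENNReal.toReal_mono (ENNReal.mul_ne_top (ENNReal.mul_ne_top ENNReal.coe_ne_top
      hfin.ne) (hΩ.memLp p f).eLpNorm_ne_top) (hbound f)
    simpa only [ENNReal.toReal_mul, ENNReal.coe_toReal] using h3
  -- Extension by continuity from the dense image of the smooth periodic functions; the norm bound
  -- there passes to the limit.
  refine ⟨F.extendOfNorm (hΩ.toLp p), fun f => ⟨hΩ.memLp p f, hΩ.memLp q (A f), ?_⟩, ?_⟩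
  · exact (LinearMap.extendOfNorm_eq hdense ⟨_, hnorm⟩ f).trans (hF f)
  · exact LinearMap.opNorm_extendOfNorm_le hdense (by positivity) hnorm
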